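/- Equip $\mathbb R^{2n+2}$ with the standard para-complex structure $\widetilde J(x_1,\dots,x_{n+1},y_1,\dots,y_{n+1})=(y_1,\dots,y_{n+1},x_1,\dots,x_{n+1})$. Let $f\colon M\to\mathbb R^{2n+2}$ be a smooth immersion of a smooth $(2n+1)$-dimensional manifold. A vector field $C$ along $f$ is transversal if $\mathbb R^{2n+2}=f_*(T_xM)\oplus\operatorname{span}\{C_x\}$ with $C_x\neq 0$ for every $x$, and $\widetilde J$-tangent if $\widetilde JC_x\in f_*(T_xM)$ for every $x$. Let $\mathcal D_x=f_*^{-1}\bigl(f_*(T_xM)\cap\widetilde J(f_*(T_xM))\bigr)$. The field $C$ defines the second fundamental form $h$ by $D_Xf_*Y=f_*(\nabla_XY)+h(X,Y)C$, and $f$ is nondegenerate (with respect to $C$) if $h$ is. For $V\subset\mathbb R^{2n}$ open, a smooth immersion $g\colon V\to\mathbb R^{2n+2}$ is a para-complex centro-affine immersion if every $g_*(T_yV)$ is $\widetilde J$-invariant, the eigenspaces of $\widetilde J|_{g_*(T_yV)}$ for $1$ and $-1$ have equal dimension, and $g(y),\widetilde Jg(y)$ are linearly independent and span a complement of $g_*(T_yV)$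 in $\mathbb R^{2n+2}$. It is nondegenerate if $h_1$ is, where $D_Xg_*Y=g_*(\nabla_XY)+h_1(X,Y)\,g+h_2(X,Y)\,\widetilde Jg$. **Theorem.** (a) Suppose that $C=-f$ is transversal and $\widetilde J$-tangent and that $\mathcal D$ is involutive. Then for every $x\in M$ there are an open set $V\subset\mathbb R^{2n}$, an open interval $I$, a para-complex centro-affine immersion $g\colon V\to\mathbb R^{2n+2}$ and smooth coordinates $(x_1,\dots,x_{2n},z)$ mapping a neighbourhood of $x$ diffeomorphically onto $V\times I$, in which $$f(x_1,\dots,x_{2n},z)=\widetilde Jg(x_1,\dots,x_{2n})\cosh z-g(x_1,\dots,x_{2n})\sinh z.$$ (b) Conversely, if $V\subset\mathbb R^{2n}$ is open and $g\colon V\to\mathbb R^{2n+2}$ is a para-complex centro-affine immersion, then the map $f\colon V\times\mathbb R\to\mathbb R^{2n+2}$ given by this formula is an immersion, $C=-f$ is transversal to $f$ and $\widetilde J$-tangent, and the distribution $\mathcal D$ of $f$ is involutive. If moreover $g$ is nondegenerate, then $f$ is nondegenerate with respect to $C=-f$. -/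

import Mathlib

open Set Module
open scoped Manifold ContDiff

noncomputable section

namespace ParaComplex

/-- The space `ℝ^{2n+2}` with coordinates `(x₁, …, x_{n+1}, y₁, …, y_{n+1})`, written `(x, y)`. -/
abbrev Ambient (n : ℕ) : Type := (Fin (n + 1) → ℝ) × (Fin (n + 1) → ℝ)

/-- The standard para-complex structure `J̃ (x, y) = (y, x)` on `ℝ^{2n+2}`. -/
def Jt (n : ℕ) : Ambient n →L[ℝ] Ambient n :=
  (ContinuousLinearMap.snd ℝ (Fin (n + 1) → ℝ) (Fin (n + 1) → ℝ)).prod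
    (ContinuousLinearMap.fst ℝ (Fin (n + 1) → ℝ) (Fin (n + 1) → ℝ))

/-- `J̃` restricts to a para-complex structure on the subspace `T`: the subspace is `J̃`-invariant
and the eigenspaces of `J̃|_T` for `1` and `-1` have equal dimension
(`J̃² = id` holds on the whole space). -/
def RestrictsToParaComplex {n : ℕ} (T : Submodule ℝ (Ambient n)) : Prop :=
  (∀ v ∈ T, Jt n v ∈ T) ∧
    finrank ℝ ↥(T ⊓ End.eigenspace (Jt n : Ambient n →ₗ[ℝ] Ambient n) 1) =
      finrank ℝ ↥(T ⊓ End.eigenspace (Jt n : Ambient n →ₗ[ℝ] Ambient n) (-1))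

section Hypersurface

variable (E : Type*) [NormedAddCommGroup E] [NormedSpace ℝ E]
  {M : Type*} [TopologicalSpace M] [ChartedSpace E M] {n : ℕ}

/-- The differential `f_* : T_xM → ℝ^{2n+2}` of a map `f : M → ℝ^{2n+2}` on a manifold `M`
modelled on `E`. -/
def pushforward (f : M → Ambient n) (x : M) : TangentSpace 𝓘(ℝ, E) x →ₗ[ℝ] Ambient n :=
  (mfderiv 𝓘(ℝ, E) 𝓘(ℝ, Ambient n) f x : E →L[ℝ] Ambient n).toLinearMap

/-- `f` is a smooth immersion on the open set `U ⊆ M` (a hypersurface if `dim E = 2n+1`). -/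
def IsImmersedOn (f : M → Ambient n) (U : Set M) : Prop :=
  ContMDiffOn 𝓘(ℝ, E) 𝓘(ℝ, Ambient n) ∞ f U ∧
    ∀ x ∈ U, Function.Injective (pushforward E f x)

/-- `C` is a smooth vector field along `f` on `U`, transversal to `f`:
`ℝ^{2n+2} = f_*(T_xM) ⊕ span {C x}`, with `C x ≠ 0`. -/
def IsTransversalOn (f C : M → Ambient n) (U : Set M) : Prop :=
  ContMDiffOn 𝓘(ℝ, E) 𝓘(ℝ, Ambient n) ∞ C U ∧
    ∀ x ∈ U, C x ≠ 0 ∧ IsCompl (LinearMap.range (pushforward E f x)) (Submodule.span ℝ {C x})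

/-- `C` is `J̃`-tangent: `J̃ (C x) ∈ f_*(T_xM)`. -/
def IsJtTangentOn (f C : M → Ambient n) (U : Set M) : Prop :=
  ∀ x ∈ U, Jt n (C x) ∈ LinearMap.range (pushforward E f x)

/-- The distribution `𝒟_x = f_*⁻¹ (f_*(T_xM) ∩ J̃ (f_*(T_xM)))`. -/
def distributionD (f : M → Ambient n) (x : M) : Submodule ℝ (TangentSpace 𝓘(ℝ, E) x) :=
  (LinearMap.range (pushforward E f x) ⊓
    (LinearMap.range (pushforward E f x)).map
      (Jt n : Ambient n →ₗ[ℝ] Ambient n)).comap (pushforward E f x)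

/-- The vector field `X` is smooth on the set `O`. -/
def IsSmoothFieldOn (X : (x : M) → TangentSpace 𝓘(ℝ, E) x) (O : Set M)
    [IsManifold 𝓘(ℝ, E) ∞ M] : Prop :=
  haveI : IsManifold 𝓘(ℝ, E) 1 M := IsManifold.of_le (n := ∞) (by simp)
  ContMDiffOn 𝓘(ℝ, E) 𝓘(ℝ, E).tangent ∞ (fun x => (⟨x, X x⟩ : TangentBundle 𝓘(ℝ, E) M)) O

/-- A distribution is involutive on the open set `U` if the bracket of any two of its smooth
sections, defined over any open subset of `U`, is again a section. -/
def IsInvolutiveOn [IsManifold 𝓘(ℝ, E) ∞ M]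
    (D : (x : M) → Submodule ℝ (TangentSpace 𝓘(ℝ, E) x)) (U : Set M) : Prop :=
  ∀ (O : Set M), IsOpen O → O ⊆ U →
    ∀ X Y : (x : M) → TangentSpace 𝓘(ℝ, E) x,
      IsSmoothFieldOn E X O → IsSmoothFieldOn E Y O →
      (∀ x ∈ O, X x ∈ D x) → (∀ x ∈ O, Y x ∈ D x) →
      ∀ x ∈ O, VectorField.mlieBracket 𝓘(ℝ, E) X Y x ∈ D x

/-- `h` is the second fundamental form of `f` with respect to the transversal field `C`:
the formula of Gauss `D_X f_*Y = f_*(∇_X Y) + h(X, Y) C` holds, for some tangent vector `∇_X Y`. -/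
def IsSecondFundamentalFormOn [IsManifold 𝓘(ℝ, E) ∞ M] (f C : M → Ambient n)
    (h : (x : M) → LinearMap.BilinForm ℝ (TangentSpace 𝓘(ℝ, E) x)) (U : Set M) : Prop :=
  ∀ (O : Set M), IsOpen O → O ⊆ U →
    ∀ Y : (x : M) → TangentSpace 𝓘(ℝ, E) x, IsSmoothFieldOn E Y O →
      ∀ x ∈ O, ∀ X : TangentSpace 𝓘(ℝ, E) x, ∃ Z : TangentSpace 𝓘(ℝ, E) x,
        pushforward E (fun y => pushforward E f y (Y y)) x X =
          pushforward E f x Z + h x X (Y x) • C x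

/-- `f` with transversal field `C` is nondegenerate: its second fundamental form is. -/
def IsNondegenerateOn [IsManifold 𝓘(ℝ, E) ∞ M] (f C : M → Ambient n) (U : Set M) : Prop :=
  ∃ h : (x : M) → LinearMap.BilinForm ℝ (TangentSpace 𝓘(ℝ, E) x),
    IsSecondFundamentalFormOn E f C h U ∧ ∀ x ∈ U, (h x).Nondegenerate

end Hypersurface

/-- `g` is a para-complex centro-affine immersion of the open set `V ⊆ ℝ^{2n}`: a smooth
immersion whose tangent spaces are `J̃`-invariant with `J̃` para-complex on them, and for which
`{g, J̃ g}` spans a transversal (two-dimensional, complementary) bundle. -/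
structure IsParaComplexCentroAffine {n : ℕ}
    (g : EuclideanSpace ℝ (Fin (2 * n)) → Ambient n)
    (V : Set (EuclideanSpace ℝ (Fin (2 * n)))) : Prop where
  smooth : ContDiffOn ℝ ∞ g V
  immersion : ∀ y ∈ V, Function.Injective (fderiv ℝ g y)
  paraHolomorphic : ∀ y ∈ V,
    RestrictsToParaComplex (LinearMap.range (fderiv ℝ g y).toLinearMap)
  independent : ∀ y ∈ V, LinearIndependent ℝ ![g y, Jt n (g y)]
  transversal : ∀ y ∈ V,
    IsCompl (LinearMap.range (fderiv ℝ g y).toLinearMap) (Submodule.span ℝ {g y, Jt n (g y)})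

/-- Nondegeneracy of a para-complex centro-affine immersion `g`: in the formula of Gauss
`D_X g_*Y = g_*(∇_X Y) + h₁(X, Y) g + h₂(X, Y) J̃ g` the form `h₁` is nondegenerate. -/
def IsParaNondegenerate {n : ℕ}
    (g : EuclideanSpace ℝ (Fin (2 * n)) → Ambient n)
    (V : Set (EuclideanSpace ℝ (Fin (2 * n)))) : Prop :=
  ∃ h₁ h₂ : EuclideanSpace ℝ (Fin (2 * n)) →
      LinearMap.BilinForm ℝ (EuclideanSpace ℝ (Fin (2 * n))),
    (∀ O : Set (EuclideanSpace ℝ (Fin (2 * n))), IsOpen O → O ⊆ V →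
      ∀ Y : EuclideanSpace ℝ (Fin (2 * n)) → EuclideanSpace ℝ (Fin (2 * n)),
        ContDiffOn ℝ ∞ Y O → ∀ y ∈ O, ∀ X, ∃ Z,
          fderiv ℝ (fun p => fderiv ℝ g p (Y p)) y X =
            fderiv ℝ g y Z + h₁ y X (Y y) • g y + h₂ y X (Y y) • Jt n (g y)) ∧
    ∀ y ∈ V, (h₁ y).Nondegenerate

/-- The map `(x₁, …, x_{2n}, z) ↦ J̃ g(x₁, …, x_{2n}) cosh z - g(x₁, …, x_{2n}) sinh z`. -/
def hyperbolicSweep {n : ℕ} (g : EuclideanSpace ℝ (Fin (2 * n)) → Ambient n) :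
    EuclideanSpace ℝ (Fin (2 * n)) × ℝ → Ambient n :=
  fun p => Real.cosh p.2 • Jt n (g p.1) - Real.sinh p.2 • g p.1

end ParaComplex

end

/-! Write `R t = exp (t J̃) = cosh t + sinh t J̃`, the one-parameter group generated by the
involution `J̃`. The sweep of `g` is `f = R (-z) (J̃ g)`, so both directions consist in removing
this rotation.

For (a), transversality of the position gives a conormal `ℓ` with `ℓ ∘ f_* = 0` and `ℓ f = 1`, and
`J̃`-tangency gives a field `ξ` with `f_* ξ = -J̃ f`. The one-form `η = -ℓ ∘ J̃ ∘ f_*` has kernel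
`𝒟` and satisfies `η ξ = 1`. It is closed: on `𝒟 × 𝒟` by involutivity, and on `𝒟 × ξ` by
differentiating the relations that define `ℓ` and `ξ` (`fderiv_contactForm_symmetric`). Hence `η =
dz` on a ball. The map `G = J̃ R(z) f` has `dG v = R(z) (η v • f + J̃ f_* v)`, whose kernel is
exactly the span of `ξ`. So `G` is constant along the flow lines of `ξ`, on which `z` is a
parameter, and descends to an immersion `g` in 2n variables (`exists_straightening`); inverting `G =
J̃ R(z) f` gives the formula for `f`. The tangent spaces of `g` are the common kernels of `l'` and
`l' ∘ J̃` for the functional `l' = ℓ ∘ R(-z) ∘ J̃`, which makes them para-complex complements of the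
span of `g` and `J̃ g` (`paraComplex_complement`).

For (b), `f_* (v, s) = R(-z) (J̃ g_* v - s g)`. Undoing the rotation reduces each claim to the
splitting into the tangent space of `g` and the span of `g` and `J̃ g`: `𝒟` is the kernel of `dz`,
and the second fundamental form for `-f` is `-(h₁ + dz²)`. -/

namespace ParaComplex

/-! ### The one-parameter group of hyperbolic rotations. -/

section HyperbolicRotation

variable {A : Type*} [NormedAddCommGroup A] [NormedSpace ℝ A]

/-- The hyperbolic rotation `exp (t J) = cosh t + sinh t J` of an involution `J`. -/
noncomputable def hypRot (J : A →L[ℝ] A) (t : ℝ) : A →L[ℝ] A :=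
  Real.cosh t • ContinuousLinearMap.id ℝ A + Real.sinh t • J

theorem hypRot_apply (J : A →L[ℝ] A) (t : ℝ) (v : A) :
    hypRot J t v = Real.cosh t • v + Real.sinh t • J v := by
  simp [hypRot]

theorem map_hypRot (J : A →L[ℝ] A) (t : ℝ) (v : A) :
    J (hypRot J t v) = hypRot J t (J v) := by
  simp [hypRot_apply]

theorem hypRot_neg_hypRot {J : A →L[ℝ] A} (hJ : ∀ v, J (J v) = v) (t : ℝ) (v : A) :
    hypRot J (-t) (hypRot J t v) = v := by
  have h : Real.cosh t * Real.cosh t = 1 + Real.sinh t * Real.sinh t := by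
    nlinarith [Real.cosh_sq t]
  simp only [hypRot_apply, map_add, map_smul, hJ, Real.cosh_neg, Real.sinh_neg, smul_add,
    smul_smul, h]
  module

theorem hypRot_hypRot_neg {J : A →L[ℝ] A} (hJ : ∀ v, J (J v) = v) (t : ℝ) (v : A) :
    hypRot J t (hypRot J (-t) v) = v := by
  simpa using hypRot_neg_hypRot hJ (-t) v

theorem hasDerivAt_hypRot {J : A →L[ℝ] A} (hJ : ∀ v, J (J v) = v) (t : ℝ) :
    HasDerivAt (hypRot J) (J ∘L hypRot J t) t := by
  have h := ((Real.hasDerivAt_cosh t).smul_const (ContinuousLinearMap.id ℝ A)).add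
    ((Real.hasDerivAt_sinh t).smul_const J)
  refine h.congr_deriv ?_
  ext v
  simp [hypRot_apply, hJ, add_comm]

theorem contDiff_hypRot (J : A →L[ℝ] A) : ContDiff ℝ ∞ (hypRot J) := by
  unfold hypRot
  exact (Real.contDiff_cosh.smul contDiff_const).add (Real.contDiff_sinh.smul contDiff_const)

/-- Product rule for a rotation by a variable angle: differentiating the angle brings down a factor
`J`. -/
theorem HasFDerivAt.hypRot_apply {E : Type*} [NormedAddCommGroup E] [NormedSpace ℝ E]
    {J : A →L[ℝ] A} (hJ : ∀ v, J (J v) = v) {z : E → ℝ} {η : E →L[ℝ] ℝ} {F : E → A}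
    {F' : E →L[ℝ] A} {x : E} (hz : HasFDerivAt z η x) (hF : HasFDerivAt F F' x) :
    HasFDerivAt (fun y => hypRot J (z y) (F y))
      (η.smulRight (J (hypRot J (z x) (F x))) + hypRot J (z x) ∘L F') x := by
  have h := ((hasDerivAt_hypRot hJ (z x)).hasFDerivAt.comp x hz).clm_apply hF
  refine h.congr_fderiv ?_
  ext v
  simp [add_comm]

end HyperbolicRotation

/-! ### The conormal, the field `ξ`, and closedness of the one-form `η`. -/

section Conormal

variable {E A : Type*} [NormedAddCommGroup E] [NormedSpace ℝ E]
  [NormedAddCommGroup A] [NormedSpace ℝ A]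

/-- For a smooth centro-affine immersion `F` whose `J`-rotated position is tangent there are a smooth
affine conormal `ℓ` and a smooth tangent field `ξ` representing `-J F`. -/
theorem exists_conormal_reeb [FiniteDimensional ℝ E] {J : A →L[ℝ] A} {F : E → A} {Ω : Set E} (hΩ : IsOpen Ω)
    (hF : ContDiffOn ℝ ∞ F Ω) (himm : ∀ x ∈ Ω, Function.Injective (fderiv ℝ F x))
    (hF0 : ∀ x ∈ Ω, F x ≠ 0)
    (htr : ∀ x ∈ Ω, IsCompl (LinearMap.range (fderiv ℝ F x).toLinearMap)
      (Submodule.span ℝ {F x}))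
    (htan : ∀ x ∈ Ω, ∃ v, fderiv ℝ F x v = J (F x)) :
    ∃ (l : E → A →L[ℝ] ℝ) (ξ : E → E), ContDiffOn ℝ ∞ l Ω ∧ ContDiffOn ℝ ∞ ξ Ω ∧
      ∀ x ∈ Ω, (∀ v, l x (fderiv ℝ F x v) = 0) ∧ l x (F x) = 1 ∧
        fderiv ℝ F x (ξ x) = -J (F x) ∧ ∀ w, l x w = 0 → ∃ v, fderiv ℝ F x v = w := by
  -- Transversality makes `L x (v, t) = F_* v + t F` an isomorphism. Both `l` (the `t`-component of
  -- its inverse) and `ξ` (the `E`-component of the preimage of `-J F`) are read off from the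
  -- inverse, hence smooth.
  let L : E → (E × ℝ) →L[ℝ] A := fun x =>
    (fderiv ℝ F x).coprod (ContinuousLinearMap.toSpanSingleton ℝ (F x))
  have hLapp : ∀ x v t, L x (v, t) = fderiv ℝ F x v + t • F x := fun x v t => by simp [L]
  have hLinv : ∀ x ∈ Ω, ∃ e : (E × ℝ) ≃L[ℝ] A, (e : (E × ℝ) →L[ℝ] A) = L x := by
    intro x hx
    have hinj : Function.Injective (L x) := by
      rw [injective_iff_map_eq_zero]
      rintro ⟨v, t⟩ h
      rw [hLapp] at h
      have h1 : t • F x = fderiv ℝ F x (-v) := by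
        rw [map_neg]; exact (neg_eq_of_add_eq_zero_right h).symm
      have h2 : t • F x = 0 := Submodule.disjoint_def.1 (htr x hx).disjoint _
        (by rw [h1]; exact ⟨-v, rfl⟩)
        (Submodule.smul_mem _ _ (Submodule.mem_span_singleton_self _))
      have h3 : t = 0 := (smul_eq_zero.1 h2).resolve_right (hF0 x hx)
      rw [h2, add_zero] at h
      have h4 : v = 0 := (injective_iff_map_eq_zero _).1 (himm x hx) v h
      simp [h3, h4]
    have hsurj : Function.Surjective (L x) := by
      intro w
      have hw : w ∈ LinearMap.range (fderiv ℝ F x).toLinearMap ⊔ Submodule.span ℝ {F x} := by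
        rw [(htr x hx).sup_eq_top]; trivial
      obtain ⟨_, ⟨v, rfl⟩, _, hb, rfl⟩ := Submodule.mem_sup.1 hw
      obtain ⟨t, rfl⟩ := Submodule.mem_span_singleton.1 hb
      exact ⟨(v, t), hLapp x v t⟩
    exact ⟨(LinearEquiv.ofBijective (L x).toLinearMap ⟨hinj, hsurj⟩).toContinuousLinearEquiv,
      by ext <;> rfl⟩
  have hLsm : ContDiffOn ℝ ∞ L Ω := by
    have h1 : ContDiffOn ℝ ∞ (fderiv ℝ F) Ω := hF.fderiv_of_isOpen hΩ (by simp)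
    have h2 : ContDiffOn ℝ ∞ (fun x => (fderiv ℝ F x) ∘L ContinuousLinearMap.fst ℝ E ℝ +
        (ContinuousLinearMap.snd ℝ E ℝ).smulRight (F x)) Ω :=
      (h1.clm_comp contDiffOn_const).add (contDiffOn_const.smulRight hF)
    refine h2.congr fun x _ => ?_
    ext v <;> simp [L]
  have hIsm : ContDiffOn ℝ ∞ (fun x => (L x).inverse) Ω := by
    intro x hx
    obtain ⟨e, he⟩ := hLinv x hx
    have h := contDiffAt_map_inverse (n := ∞) e
    rw [he] at h
    exact h.comp_contDiffWithinAt x (hLsm x hx)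
  have hI1 : ∀ x ∈ Ω, ∀ p, (L x).inverse (L x p) = p := by
    intro x hx p
    obtain ⟨e, he⟩ := hLinv x hx
    rw [← he]; simp
  have hI2 : ∀ x ∈ Ω, ∀ w, L x ((L x).inverse w) = w := by
    intro x hx p
    obtain ⟨e, he⟩ := hLinv x hx
    rw [← he]; simp
  refine ⟨fun x => ContinuousLinearMap.snd ℝ E ℝ ∘L (L x).inverse,
    fun x => ((L x).inverse (-J (F x))).1, contDiffOn_const.clm_comp hIsm,
    (hIsm.clm_apply ((J.contDiff.comp_contDiffOn hF).neg)).fst, fun x hx => ⟨?_, ?_, ?_, ?_⟩⟩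
  · intro v
    have := hI1 x hx (v, 0)
    rw [hLapp, zero_smul, add_zero] at this
    simp [this]
  · have := hI1 x hx (0, 1)
    rw [hLapp, map_zero, zero_add, one_smul] at this
    simp [this]
  · obtain ⟨v, hv⟩ := htan x hx
    have := hI1 x hx (-v, 0)
    rw [hLapp, zero_smul, add_zero, map_neg, hv] at this
    simp [this, hv]
  · intro w hw
    refine ⟨((L x).inverse w).1, ?_⟩
    have h := hI2 x hx w
    have h2 : (L x).inverse w = (((L x).inverse w).1, 0) := Prod.ext rfl hw
    rw [h2, hLapp] at h
    simpa using h

/-- Differentiating the pairing of a one-form with a vector field which is locally constant. -/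
theorem fderiv_apply_add_apply_fderiv_eq_zero {G : Type*} [NormedAddCommGroup G] [NormedSpace ℝ G]
    {B : Type*} [NormedAddCommGroup B] [NormedSpace ℝ B]
    {η : E → B →L[ℝ] G} {W : E → B} {x : E} {c : G} (hη : DifferentiableAt ℝ η x)
    (hW : DifferentiableAt ℝ W x) (h : ∀ᶠ y in nhds x, η y (W y) = c) (u : E) :
    fderiv ℝ η x u (W x) + η x (fderiv ℝ W x u) = 0 := by
  have h1 := hη.hasFDerivAt.clm_apply hW.hasFDerivAt
  have h2 : HasFDerivAt (fun y => η y (W y)) (0 : E →L[ℝ] G) x :=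
    (hasFDerivAt_const c x).congr_of_eventuallyEq h
  have h3 := congrArg (fun T : E →L[ℝ] G => T u) (h1.unique h2)
  simpa [add_comm] using h3

/-- The one-form `-ℓ ∘ J ∘ F_*` is closed if its kernel is involutive. -/
theorem fderiv_contactForm_symmetric {J : A →L[ℝ] A} (hJ : ∀ v, J (J v) = v)
    {F : E → A} {Ω : Set E} (hΩ : IsOpen Ω)
    (hF : ContDiffOn ℝ ∞ F Ω) {l : E → A →L[ℝ] ℝ} {ξ : E → E}
    (hl : ContDiffOn ℝ ∞ l Ω) (hξ : ContDiffOn ℝ ∞ ξ Ω)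
    (hlF : ∀ x ∈ Ω, ∀ v, l x (fderiv ℝ F x v) = 0) (hl1 : ∀ x ∈ Ω, l x (F x) = 1)
    (hξF : ∀ x ∈ Ω, fderiv ℝ F x (ξ x) = -J (F x))
    (hlr : ∀ x ∈ Ω, ∀ w, l x w = 0 → ∃ v, fderiv ℝ F x v = w)
    {η : E → E →L[ℝ] ℝ} (hη : ∀ x, η x = -(l x ∘L J ∘L fderiv ℝ F x))
    (hinv : ∀ X Y : E → E, ContDiffOn ℝ ∞ X Ω → ContDiffOn ℝ ∞ Y Ω →
      (∀ x ∈ Ω, η x (X x) = 0) → (∀ x ∈ Ω, η x (Y x) = 0) →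
      ∀ x ∈ Ω, η x (VectorField.lieBracket ℝ X Y x) = 0) :
    ContDiffOn ℝ ∞ η Ω ∧ ∀ x ∈ Ω, ∀ u v, fderiv ℝ η x u v = fderiv ℝ η x v u := by
  have hDF : ContDiffOn ℝ ∞ (fderiv ℝ F) Ω := hF.fderiv_of_isOpen hΩ (by simp)
  have hηapp : ∀ x v, η x v = -l x (J (fderiv ℝ F x v)) := fun x v => by simp [hη]
  have hηsm : ContDiffOn ℝ ∞ η Ω := by
    have : η = fun x => -(l x ∘L J ∘L fderiv ℝ F x) := funext hη
    rw [this]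
    exact (hl.clm_comp (contDiffOn_const.clm_comp hDF)).neg
  have hηξ : ∀ x ∈ Ω, η x (ξ x) = 1 := fun x hx => by
    rw [hηapp, hξF x hx, map_neg, hJ, map_neg, neg_neg, hl1 x hx]
  refine ⟨hηsm, fun x hx => ?_⟩
  have hnh : Ω ∈ nhds x := hΩ.mem_nhds hx
  have dη : DifferentiableAt ℝ η x := (hηsm.contDiffAt hnh).differentiableAt (by simp)
  have dl : DifferentiableAt ℝ l x := (hl.contDiffAt hnh).differentiableAt (by simp)
  have dξ : DifferentiableAt ℝ ξ x := (hξ.contDiffAt hnh).differentiableAt (by simp)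
  have dF : DifferentiableAt ℝ F x := (hF.contDiffAt hnh).differentiableAt (by simp)
  have dDF : DifferentiableAt ℝ (fderiv ℝ F) x := (hDF.contDiffAt hnh).differentiableAt (by simp)
  have hB : ∀ u v, fderiv ℝ (fderiv ℝ F) x u v = fderiv ℝ (fderiv ℝ F) x v u :=
    ((hF.contDiffAt hnh).isSymmSndFDerivAt (by
      rw [minSmoothness_of_isRCLikeNormedField]; exact WithTop.coe_le_coe.2 (le_top : (2 : ℕ∞) ≤ ⊤)))
  -- Projection of a constant field to `ker η` along `ξ`: these fields and `ξ` span every tangent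
  -- space, so symmetry need only be tested on them.
  let P : E → E → E := fun u y => u - η y u • ξ y
  have hPsm : ∀ u, ContDiffOn ℝ ∞ (P u) Ω := fun u =>
    contDiffOn_const.sub ((hηsm.clm_apply contDiffOn_const).smul hξ)
  have dP : ∀ u, DifferentiableAt ℝ (P u) x := fun u =>
    ((hPsm u).contDiffAt hnh).differentiableAt (by simp)
  have hηP : ∀ u, ∀ y ∈ Ω, η y (P u y) = 0 := fun u y hy => by
    simp [P, hηξ y hy]
  have e1 : ∀ u w, fderiv ℝ η x w (P u x) + η x (fderiv ℝ (P u) x w) = 0 := fun u w =>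
    fderiv_apply_add_apply_fderiv_eq_zero dη (dP u)
      (Filter.eventually_of_mem hnh (hηP u)) w
  have e2 : ∀ w, fderiv ℝ η x w (ξ x) + η x (fderiv ℝ ξ x w) = 0 := fun w =>
    fderiv_apply_add_apply_fderiv_eq_zero dη dξ (Filter.eventually_of_mem hnh hηξ) w
  -- Since `η` vanishes on both fields, the antisymmetric part of its derivative on them is, up to
  -- sign, `η` of their bracket. This is the only use of involutivity.
  have s1 : ∀ u v, fderiv ℝ η x (P u x) (P v x) = fderiv ℝ η x (P v x) (P u x) := by
    intro u v
    have h := hinv (P u) (P v) (hPsm u) (hPsm v) (hηP u) (hηP v) x hx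
    rw [VectorField.lieBracket, map_sub] at h
    linarith [e1 u (P v x), e1 v (P u x)]
  have f1 : ∀ u w, fderiv ℝ l x u (fderiv ℝ F x w) + l x (fderiv ℝ (fderiv ℝ F) x u w) = 0 := by
    intro u w
    have h1 : DifferentiableAt ℝ (fun y => fderiv ℝ F y w) x := dDF.clm_apply
      (differentiableAt_const w)
    have h := fderiv_apply_add_apply_fderiv_eq_zero dl h1
      (Filter.eventually_of_mem hnh fun y hy => hlF y hy w) u
    rw [fderiv_clm_apply dDF (differentiableAt_const w)] at h
    simpa using h
  have f2 : ∀ u, fderiv ℝ (fderiv ℝ F) x u (ξ x) + fderiv ℝ F x (fderiv ℝ ξ x u) =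
      -J (fderiv ℝ F x u) := by
    intro u
    have h1 := dDF.hasFDerivAt.clm_apply dξ.hasFDerivAt
    have h2 : HasFDerivAt (fun y => fderiv ℝ F y (ξ y)) (-(J ∘L fderiv ℝ F x)) x :=
      ((J.hasFDerivAt.comp x dF.hasFDerivAt).neg).congr_of_eventuallyEq
        (Filter.eventually_of_mem hnh hξF)
    have h3 := congrArg (fun T : E →L[ℝ] A => T u) (h1.unique h2)
    simpa [add_comm] using h3
  -- As `P u` lies in `ker η`, `J F_*(P u)` is tangent, say `F_* Y`. By `f1` and symmetry of the
  -- second derivative the quantity is `-l (D²F(Y, ξ))`, which by `f2` equals `l (J F_* Y) = l (F_*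
  -- (P u)) = 0`.
  have f3 : ∀ u, fderiv ℝ l x (ξ x) (J (fderiv ℝ F x (P u x))) = 0 := by
    intro u
    have hz : l x (J (fderiv ℝ F x (P u x))) = 0 := by
      have := hηP u x hx
      rw [hηapp] at this
      linarith
    obtain ⟨Y, hY⟩ := hlr x hx _ hz
    have h1 := f1 (ξ x) Y
    have h2 := congrArg (l x) (f2 Y)
    rw [map_add, hlF x hx, add_zero, hY, hJ, map_neg, hlF x hx, neg_zero] at h2
    rw [hB, h2, add_zero, hY] at h1
    exact h1
  -- With `U = P u`, both `η (D_ξ U)` and `η (D_U ξ)` equal `l (J D²F(U, ξ))`: the first by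
  -- differentiating `l (J F_* U) = 0` along `ξ` and using `f3`, the second by applying `l ∘ J` to
  -- `f2`.
  have s2 : ∀ u, fderiv ℝ η x (P u x) (ξ x) = fderiv ℝ η x (ξ x) (P u x) := by
    intro u
    have h1 : DifferentiableAt ℝ (fun y => J (fderiv ℝ F y (P u y))) x :=
      J.differentiableAt.comp x (dDF.clm_apply (dP u))
    have h := fderiv_apply_add_apply_fderiv_eq_zero dl h1 (c := 0)
      (Filter.eventually_of_mem hnh fun y hy => by
        have := hηP u y hy
        rw [hηapp] at this
        linarith) (ξ x)
    have h2 : fderiv ℝ (fun y => J (fderiv ℝ F y (P u y))) x (ξ x) =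
        J (fderiv ℝ (fderiv ℝ F) x (ξ x) (P u x) + fderiv ℝ F x (fderiv ℝ (P u) x (ξ x))) := by
      have h3 := (J.hasFDerivAt.comp x (dDF.hasFDerivAt.clm_apply (dP u).hasFDerivAt)).fderiv
      have h4 := congrArg (fun T : E →L[ℝ] A => T (ξ x)) h3
      simpa [add_comm, Function.comp_def] using h4
    rw [h2, f3, zero_add, map_add, map_add] at h
    have h5 := congrArg (fun w => l x (J w)) (f2 (P u x))
    simp only [map_add, map_neg, hJ, hlF x hx, neg_zero] at h5
    have h6 := e1 u (ξ x)
    have h7 := e2 (P u x)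
    rw [hηapp] at h6 h7
    rw [hB] at h
    linarith
  intro u v
  have hu : u = P u x + η x u • ξ x := by simp [P]
  have hv : v = P v x + η x v • ξ x := by simp [P]
  have key : ∀ (a b : ℝ) (p q r : E), fderiv ℝ η x (p + a • r) (q + b • r) =
      fderiv ℝ η x p q + b * fderiv ℝ η x p r + a * fderiv ℝ η x r q +
        a * b * fderiv ℝ η x r r := by
    intro a b p q r
    simp only [map_add, map_smul, add_apply, smul_apply,
      smul_eq_mul]
    ring
  rw [hu, hv, key, key, s1 u v, s2 u, s2 v]
  ring

end Conormal

end ParaComplex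

/-! ### Straightening a map with one-dimensional kernel. -/

namespace ParaComplex

/-- A map `G` whose differential has kernel spanned by a field `ξ` with `dz ξ = 1` descends, in
suitable coordinates whose last one is `z`, to an immersion of an open set one dimension lower. -/
theorem exists_straightening {m : ℕ} {E A : Type*} [NormedAddCommGroup E] [NormedSpace ℝ E]
    [FiniteDimensional ℝ E] [NormedAddCommGroup A] [NormedSpace ℝ A] [FiniteDimensional ℝ A]
    (hE : finrank ℝ E = m + 1) {G : E → A} {z : E → ℝ} {ξ : E → E} {B : Set E} (hB : IsOpen B)
    (hG : ContDiffOn ℝ ∞ G B) (hz : ContDiffOn ℝ ∞ z B)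
    (hGξ : ∀ x ∈ B, fderiv ℝ G x (ξ x) = 0) (hzξ : ∀ x ∈ B, fderiv ℝ z x (ξ x) = 1)
    (hker : ∀ x ∈ B, ∀ v, fderiv ℝ G x v = 0 → ∃ c : ℝ, v = c • ξ x) {x₀ : E} (hx₀ : x₀ ∈ B) :
    ∃ (V : Set (EuclideanSpace ℝ (Fin m))) (a b : ℝ) (g : EuclideanSpace ℝ (Fin m) → A)
      (ψ : OpenPartialHomeomorph E (EuclideanSpace ℝ (Fin m) × ℝ)),
      IsOpen V ∧ x₀ ∈ ψ.source ∧ ψ.source ⊆ B ∧ ψ.target = V ×ˢ Ioo a b ∧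
      ContDiffOn ℝ ∞ ψ ψ.source ∧ ContDiffOn ℝ ∞ ψ.symm ψ.target ∧ ContDiffOn ℝ ∞ g V ∧
      (∀ p ∈ ψ.target, G (ψ.symm p) = g p.1 ∧ z (ψ.symm p) = p.2) ∧
      ∀ v ∈ V, ∃ y ∈ B, g v = G y ∧ Function.Injective (fderiv ℝ g v) ∧
        LinearMap.range (fderiv ℝ g v).toLinearMap =
          LinearMap.range (fderiv ℝ G y).toLinearMap := by
  have dG : ∀ x ∈ B, HasFDerivAt G (fderiv ℝ G x) x := fun x hx =>
    ((hG.contDiffAt (hB.mem_nhds hx)).differentiableAt (by simp)).hasFDerivAt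
  have dz : ∀ x ∈ B, HasFDerivAt z (fderiv ℝ z x) x := fun x hx =>
    ((hz.contDiffAt (hB.mem_nhds hx)).differentiableAt (by simp)).hasFDerivAt
  -- By rank-nullity the image of `dG` at `x₀` has dimension `m`; extending an isomorphism of it
  -- with `ℝ^m` linearly to `A` gives `π`, and then `(π ∘ G, z)` has invertible differential at
  -- `x₀`.
  obtain ⟨π, hπ⟩ : ∃ π : A →L[ℝ] EuclideanSpace ℝ (Fin m),
      ∀ v, π (fderiv ℝ G x₀ v) = 0 → fderiv ℝ G x₀ v = 0 := by
    have hk : LinearMap.ker (fderiv ℝ G x₀).toLinearMap = Submodule.span ℝ {ξ x₀} := by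
      ext v
      rw [LinearMap.mem_ker, Submodule.mem_span_singleton]
      constructor
      · intro h
        obtain ⟨c, hc⟩ := hker x₀ hx₀ v h
        exact ⟨c, hc.symm⟩
      · rintro ⟨c, rfl⟩
        simp [hGξ x₀ hx₀]
    have hξ0 : ξ x₀ ≠ 0 := fun h => by simpa [h] using hzξ x₀ hx₀
    have hr := LinearMap.finrank_range_add_finrank_ker (fderiv ℝ G x₀).toLinearMap
    rw [hk, finrank_span_singleton hξ0, hE] at hr
    have hfr : finrank ℝ (LinearMap.range (fderiv ℝ G x₀).toLinearMap) =
        finrank ℝ (EuclideanSpace ℝ (Fin m)) := by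
      rw [finrank_euclideanSpace_fin]; omega
    obtain ⟨π, hπ⟩ := LinearMap.exists_extend (LinearEquiv.ofFinrankEq _ _ hfr).toLinearMap
    refine ⟨LinearMap.toContinuousLinearMap π, fun v hv => ?_⟩
    have h := LinearMap.congr_fun hπ ⟨fderiv ℝ G x₀ v, v, rfl⟩
    have h2 : LinearEquiv.ofFinrankEq _ _ hfr ⟨fderiv ℝ G x₀ v, v, rfl⟩ = 0 := h.symm.trans hv
    exact congrArg Subtype.val ((LinearEquiv.map_eq_zero_iff _).1 h2)
  let Φ : E → EuclideanSpace ℝ (Fin m) × ℝ := fun x => (π (G x), z x)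
  let Φ' : E → E →L[ℝ] EuclideanSpace ℝ (Fin m) × ℝ := fun x =>
    (π ∘L fderiv ℝ G x).prod (fderiv ℝ z x)
  have hΦ : ContDiffOn ℝ ∞ Φ B := (π.contDiff.comp_contDiffOn hG).prodMk hz
  have dΦ : ∀ x ∈ B, HasFDerivAt Φ (Φ' x) x := fun x hx =>
    (π.hasFDerivAt.comp x (dG x hx)).prodMk (dz x hx)
  have hΦξ : ∀ x ∈ B, Φ' x (ξ x) = (0, 1) := fun x hx => by
    simp [Φ', hGξ x hx, hzξ x hx]
  have hinj : Function.Injective (Φ' x₀) := by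
    rw [injective_iff_map_eq_zero]
    intro v hv
    obtain ⟨c, rfl⟩ := hker x₀ hx₀ v (hπ v (congrArg Prod.fst hv))
    have h : fderiv ℝ z x₀ (c • ξ x₀) = 0 := congrArg Prod.snd hv
    rw [map_smul, hzξ x₀ hx₀, smul_eq_mul, mul_one] at h
    simp [h]
  have hdim : finrank ℝ E = finrank ℝ (EuclideanSpace ℝ (Fin m) × ℝ) := by
    rw [hE, finrank_prod, finrank_euclideanSpace_fin, finrank_self]
  have hΦ'c : ContinuousOn Φ' B := by
    refine (hΦ.continuousOn_fderiv_of_isOpen hB (by simp)).congr fun x hx => (dΦ x hx).fderiv.symm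
  let N : Set (E →L[ℝ] EuclideanSpace ℝ (Fin m) × ℝ) :=
    range fun e : E ≃L[ℝ] EuclideanSpace ℝ (Fin m) × ℝ => (e : E →L[ℝ] _)
  have hN : IsOpen N := ContinuousLinearEquiv.isOpen
  have hx₀N : Φ' x₀ ∈ N :=
    ⟨(LinearEquiv.ofBijective (Φ' x₀).toLinearMap
      ⟨hinj, (LinearMap.injective_iff_surjective_of_finrank_eq_finrank hdim).1 hinj⟩
      ).toContinuousLinearEquiv, by ext <;> rfl⟩
  have hB' : IsOpen (B ∩ Φ' ⁻¹' N) := hΦ'c.isOpen_inter_preimage hB hN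
  obtain ⟨e₀, he₀⟩ := hx₀N
  change (e₀ : E →L[ℝ] _) = Φ' x₀ at he₀
  have hs₀ : HasStrictFDerivAt Φ (e₀ : E →L[ℝ] _) x₀ :=
    (hΦ.contDiffAt (hB.mem_nhds hx₀)).hasStrictFDerivAt' (by rw [he₀]; exact dΦ x₀ hx₀) (by simp)
  -- The inverse function theorem at `x₀` gives only a homeomorphism nearby; restricting to points
  -- where `Φ'` is invertible makes the inverse smooth on the whole target.
  let θ := (hs₀.toOpenPartialHomeomorph Φ).restrOpen _ hB'
  have hθ : ∀ x, θ x = Φ x := fun x => rfl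
  have hx₀θ : x₀ ∈ θ.source := ⟨hs₀.mem_toOpenPartialHomeomorph_source, hx₀, ⟨e₀, he₀⟩⟩
  have hθB : ∀ x ∈ θ.source, x ∈ B ∧ Φ' x ∈ N := fun x hx => hx.2
  have hθsymm : ∀ p ∈ θ.target, ContDiffAt ℝ ∞ θ.symm p := by
    intro p hp
    obtain ⟨hb, e, he⟩ := hθB _ (θ.map_target hp)
    change (e : E →L[ℝ] _) = Φ' (θ.symm p) at he
    exact θ.contDiffAt_symm hp (f₀' := e) (by rw [he]; exact dΦ _ hb)
      (hΦ.contDiffAt (hB.mem_nhds hb))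
  obtain ⟨r, hr, hrt⟩ := Metric.isOpen_iff.1 θ.open_target _ (θ.map_source hx₀θ)
  let V := Metric.ball (θ x₀).1 r
  let I := Metric.ball (θ x₀).2 r
  have hVI : V ×ˢ I ⊆ θ.target := by
    intro p hp
    apply hrt
    rw [← Prod.mk.eta (p := θ x₀), ← ball_prod_same]
    exact hp
  have hVIo : IsOpen (V ×ˢ I) := Metric.isOpen_ball.prod Metric.isOpen_ball
  let ψ := (θ.symm.restrOpen _ hVIo).symm
  have hψt : ψ.target = V ×ˢ I := by
    change θ.target ∩ V ×ˢ I = V ×ˢ I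
    exact inter_eq_right.2 hVI
  have hψs : ψ.source ⊆ θ.source := fun x hx => by
    have := ψ.map_source hx
    rw [hψt] at this
    have h2 := θ.map_target (hVI this)
    have h3 : ψ.symm (ψ x) = x := ψ.left_inv hx
    change ψ.symm (ψ x) ∈ θ.source at h2
    rwa [h3] at h2
  have hψs1 : ∀ p, ψ.symm p = θ.symm p := fun p => rfl
  have hc : (θ x₀).2 ∈ I := Metric.mem_ball_self hr
  have hxI : (θ x₀) ∈ V ×ˢ I := ⟨Metric.mem_ball_self hr, hc⟩
  have hx₀ψ : x₀ ∈ ψ.source := by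
    have h := ψ.map_target (x := θ x₀) (by rw [hψt]; exact hxI)
    rwa [hψs1, θ.left_inv hx₀θ] at h
  have hΦsymm : ∀ p ∈ V ×ˢ I, Φ (θ.symm p) = p := fun p hp => θ.right_inv (hVI hp)
  have hBsymm : ∀ p ∈ V ×ˢ I, θ.symm p ∈ B ∧ Φ' (θ.symm p) ∈ N := fun p hp =>
    hθB _ (θ.map_target (hVI hp))
  have dθ : ∀ p ∈ V ×ˢ I, HasFDerivAt θ.symm (fderiv ℝ θ.symm p) p := fun p hp =>
    ((hθsymm p (hVI hp)).differentiableAt (by simp)).hasFDerivAt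
  have hΦθ : ∀ p ∈ V ×ˢ I, ∀ w, Φ' (θ.symm p) (fderiv ℝ θ.symm p w) = w := by
    intro p hp w
    have h1 := (dΦ _ (hBsymm p hp).1).comp p (dθ p hp)
    have h2 : HasFDerivAt (Φ ∘ θ.symm) (ContinuousLinearMap.id ℝ _) p :=
      (hasFDerivAt_id p).congr_of_eventuallyEq
        (Filter.eventually_of_mem (hVIo.mem_nhds hp) hΦsymm)
    exact congrArg (fun T : _ →L[ℝ] _ => T w) (h1.unique h2)
  have hΦinj : ∀ p ∈ V ×ˢ I, Function.Injective (Φ' (θ.symm p)) := by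
    intro p hp
    obtain ⟨e, he⟩ := (hBsymm p hp).2
    rw [← he]
    exact e.injective
  -- In these coordinates `ξ` is `∂/∂z`, so `G` does not depend on the last coordinate and `g` can
  -- be defined on one slice.
  have hθ01 : ∀ p ∈ V ×ˢ I, fderiv ℝ θ.symm p (0, 1) = ξ (θ.symm p) := fun p hp =>
    hΦinj p hp (by rw [hΦθ p hp, hΦξ _ (hBsymm p hp).1])
  let g : EuclideanSpace ℝ (Fin m) → A := fun v => G (θ.symm (v, (θ x₀).2))
  have hconst : ∀ p ∈ V ×ˢ I, G (θ.symm p) = g p.1 := by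
    rintro ⟨v, t⟩ ⟨hv, ht⟩
    have hd : ∀ s ∈ I, HasDerivAt (fun s => G (θ.symm (v, s))) 0 s := by
      intro s hs
      have hp : (v, s) ∈ V ×ˢ I := ⟨hv, hs⟩
      have h1 := (dG _ (hBsymm _ hp).1).comp (v, s) (dθ _ hp)
      have h2 : HasDerivAt (fun s : ℝ => (v, s)) ((0 : EuclideanSpace ℝ (Fin m)), (1 : ℝ)) s :=
        (hasDerivAt_const s v).prodMk (hasDerivAt_id s)
      have h3 := h1.comp_hasDerivAt s h2
      refine h3.congr_deriv ?_
      simp [hθ01 _ hp, hGξ _ (hBsymm _ hp).1]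
    exact Metric.isOpen_ball.is_const_of_deriv_eq_zero (convex_ball _ _).isPreconnected
      (fun s hs => (hd s hs).differentiableAt.differentiableWithinAt)
      (fun s hs => (hd s hs).deriv) ht hc
  have hgd : ∀ v ∈ V, HasFDerivAt g (fderiv ℝ G (θ.symm (v, (θ x₀).2)) ∘L
      fderiv ℝ θ.symm (v, (θ x₀).2) ∘L ContinuousLinearMap.inl ℝ _ ℝ) v := by
    intro v hv
    have hp : (v, (θ x₀).2) ∈ V ×ˢ I := ⟨hv, hc⟩
    exact (dG _ (hBsymm _ hp).1).comp v ((dθ _ hp).comp v (hasFDerivAt_prodMk_left v (θ x₀).2))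
  refine ⟨V, (θ x₀).2 - r, (θ x₀).2 + r, g, ψ, Metric.isOpen_ball, hx₀ψ,
    fun x hx => (hθB x (hψs hx)).1, by rw [hψt, ← Real.ball_eq_Ioo],
    hΦ.mono fun x hx => (hθB x (hψs hx)).1, ?_, ?_, ?_, ?_⟩
  · rw [hψt]
    exact fun p hp => (hθsymm p (hVI hp)).contDiffWithinAt
  · intro v hv
    have hp : (v, (θ x₀).2) ∈ V ×ˢ I := ⟨hv, hc⟩
    exact (((hG.contDiffAt (hB.mem_nhds (hBsymm _ hp).1)).comp _ (hθsymm _ (hVI hp))).comp v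
      (contDiff_prodMk_left _).contDiffAt).contDiffWithinAt
  · rw [hψt]
    exact fun p hp => ⟨hconst p hp, congrArg Prod.snd (hΦsymm p hp)⟩
  · intro v hv
    have hp : (v, (θ x₀).2) ∈ V ×ˢ I := ⟨hv, hc⟩
    have hb := (hBsymm _ hp).1
    refine ⟨_, hb, rfl, ?_, ?_⟩
    · rw [(hgd v hv).fderiv, injective_iff_map_eq_zero]
      intro w hw
      obtain ⟨c, hc⟩ := hker _ hb _ hw
      have h := congrArg (Φ' (θ.symm (v, (θ x₀).2))) hc
      erw [hΦθ _ hp] at h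
      rw [map_smul, hΦξ _ hb] at h
      simpa using congrArg Prod.fst h
    · rw [(hgd v hv).fderiv]
      refine le_antisymm (fun _ ⟨w, hw⟩ => ⟨_, hw⟩) ?_
      rintro _ ⟨u, rfl⟩
      have h : u = fderiv ℝ θ.symm (v, (θ x₀).2) (Φ' (θ.symm (v, (θ x₀).2)) u) :=
        hΦinj _ hp (by rw [hΦθ _ hp])
      refine ⟨(Φ' (θ.symm (v, (θ x₀).2)) u).1, ?_⟩
      -- The `z`-component of `q` maps to a multiple of `ξ`, which `dG` kills; so slice directions
      -- already give the full range of `dG`.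
      have h2 : ∀ q : EuclideanSpace ℝ (Fin m) × ℝ, fderiv ℝ G (θ.symm (v, (θ x₀).2))
          (fderiv ℝ θ.symm (v, (θ x₀).2) (q.1, 0)) = fderiv ℝ G (θ.symm (v, (θ x₀).2))
          (fderiv ℝ θ.symm (v, (θ x₀).2) q) := by
        intro q
        have hq : q = (q.1, 0) + q.2 • ((0 : EuclideanSpace ℝ (Fin m)), (1 : ℝ)) := by
          ext <;> simp
        conv_rhs => rw [hq]
        rw [map_add, map_smul, hθ01 _ hp, map_add, map_smul, hGξ _ hb, smul_zero, add_zero]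
      exact (h2 _).trans (congrArg _ h.symm)

end ParaComplex

/-! ### Para-complex complements, and the local form of part (a) in a vector space. -/

namespace ParaComplex

theorem Jt_Jt {n : ℕ} (v : Ambient n) : Jt n (Jt n v) = v := rfl

/-- The intersection of an eigenspace of `J̃` with the kernel of a functional nonzero on it. -/
theorem finrank_inf_eigenspace_Jt {n : ℕ} {T : Submodule ℝ (Ambient n)} {l : Ambient n →L[ℝ] ℝ}
    (hT : ∀ w, w ∈ T ↔ l w = 0 ∧ l (Jt n w) = 0) {ε : ℝ} (hε : ε * ε = 1)
    {w₀ : Ambient n} (hw₀ : Jt n w₀ = ε • w₀) (hl : l w₀ ≠ 0) :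
    finrank ℝ ↥(T ⊓ End.eigenspace (Jt n : Ambient n →ₗ[ℝ] Ambient n) ε) = n := by
  -- The `ε`-eigenspace is the graph of `ε • id`, of dimension `n + 1`. On it the second condition
  -- of `hT` follows from the first, so one nonzero functional cuts out dimension `n`.
  let ι : (Fin (n + 1) → ℝ) →ₗ[ℝ] Ambient n := LinearMap.prod LinearMap.id (ε • LinearMap.id)
  have hι : ∀ x, ι x = (x, ε • x) := fun x => rfl
  have hιinj : Function.Injective ι := fun x y h => congrArg Prod.fst h
  have hJι : ∀ x, Jt n (ι x) = ε • ι x := fun x => by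
    rw [hι]
    exact Prod.ext rfl (by simp [smul_smul, hε, Jt])
  have heig : ∀ w, Jt n w = ε • w → w = ι w.1 := fun w hw =>
    Prod.ext rfl (congrArg Prod.fst hw)
  let φ : (Fin (n + 1) → ℝ) →ₗ[ℝ] ℝ := l.toLinearMap ∘ₗ ι
  have hmap : T ⊓ End.eigenspace (Jt n : Ambient n →ₗ[ℝ] Ambient n) ε =
      (LinearMap.ker φ).map ι := by
    ext w
    rw [Submodule.mem_inf, hT, End.mem_eigenspace_iff, Submodule.mem_map]
    constructor
    · rintro ⟨⟨h1, _⟩, h2⟩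
      have hw := heig w h2
      exact ⟨w.1, by rw [LinearMap.mem_ker]; change l (ι w.1) = 0; rw [← hw, h1], hw.symm⟩
    · rintro ⟨x, hx, rfl⟩
      have hx' : l (ι x) = 0 := hx
      exact ⟨⟨hx', by rw [hJι, map_smul, hx', smul_zero]⟩, hJι x⟩
  have hsurj : Function.Surjective φ := by
    apply LinearMap.surjective
    intro h
    apply hl
    rw [heig w₀ hw₀]
    exact LinearMap.congr_fun h w₀.1
  have hr := LinearMap.finrank_range_add_finrank_ker φ
  rw [LinearMap.range_eq_top.2 hsurj, finrank_top, finrank_self, finrank_fin_fun] at hr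
  rw [hmap, ← (Submodule.equivMapOfInjective ι hιinj (LinearMap.ker φ)).finrank_eq]
  omega

/-- The common kernel of `l` and `l ∘ J̃`, where `l g = 1` and `l (J̃ g) = 0`, is a para-complex
complement of the span of `g` and `J̃ g`. -/
theorem paraComplex_complement {n : ℕ} {T : Submodule ℝ (Ambient n)} {l : Ambient n →L[ℝ] ℝ}
    (hT : ∀ w, w ∈ T ↔ l w = 0 ∧ l (Jt n w) = 0) {g : Ambient n} (hg : l g = 1)
    (hJg : l (Jt n g) = 0) :
    RestrictsToParaComplex T ∧ LinearIndependent ℝ ![g, Jt n g] ∧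
      IsCompl T (Submodule.span ℝ {g, Jt n g}) := by
  have key : ∀ a b : ℝ, l (a • g + b • Jt n g) = a ∧ l (Jt n (a • g + b • Jt n g)) = b := by
    intro a b
    simp [Jt_Jt, hg, hJg]
  refine ⟨⟨fun v hv => ?_, ?_⟩, ?_, ?_⟩
  · rw [hT] at hv ⊢
    exact ⟨hv.2, by rw [Jt_Jt]; exact hv.1⟩
  -- The eigenvectors `g ± J̃ g` both have `l`-value `1`, so `l` is nonzero on each eigenspace.
  · rw [finrank_inf_eigenspace_Jt hT (by norm_num) (w₀ := g + Jt n g)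
        (by rw [map_add, Jt_Jt, one_smul, add_comm]) (by simp [hg, hJg]),
      finrank_inf_eigenspace_Jt hT (by norm_num) (w₀ := g - Jt n g)
        (by rw [map_sub, Jt_Jt, neg_one_smul, neg_sub]) (by simp [hg, hJg])]
  · rw [LinearIndependent.pair_iff]
    intro a b h
    have := key a b
    rw [h] at this
    simpa [eq_comm] using this
  · refine ⟨Submodule.disjoint_def.2 fun w hw hs => ?_, codisjoint_iff.2 ?_⟩
    · obtain ⟨a, b, rfl⟩ := Submodule.mem_span_pair.1 hs
      rw [hT, (key a b).1, (key a b).2] at hw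
      simp [hw.1, hw.2]
    · rw [eq_top_iff]
      intro w _
      have h := key (l w) (l (Jt n w))
      refine Submodule.mem_sup.2 ⟨w - (l w • g + l (Jt n w) • Jt n g), ?_,
        _, Submodule.mem_span_pair.2 ⟨l w, l (Jt n w), rfl⟩, sub_add_cancel _ _⟩
      rw [hT, map_sub, map_sub, map_sub, h.1, h.2]
      simp

/-- Local structure of a centro-affine hypersurface with `J̃`-tangent position and involutive
`J̃`-invariant distribution, for a map defined on an open subset of a vector space. -/
theorem exists_hyperbolicSweep_coordinates {n : ℕ} {E : Type*} [NormedAddCommGroup E]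
    [NormedSpace ℝ E] [FiniteDimensional ℝ E] (hE : finrank ℝ E = 2 * n + 1)
    {F : E → Ambient n} {Ω : Set E} (hΩ : IsOpen Ω)
    (hF : ContDiffOn ℝ ∞ F Ω) (himm : ∀ x ∈ Ω, Function.Injective (fderiv ℝ F x))
    (hF0 : ∀ x ∈ Ω, F x ≠ 0)
    (htr : ∀ x ∈ Ω, IsCompl (LinearMap.range (fderiv ℝ F x).toLinearMap)
      (Submodule.span ℝ {F x}))
    (htan : ∀ x ∈ Ω, ∃ v, fderiv ℝ F x v = Jt n (F x))
    (hinv : ∀ X Y : E → E, ContDiffOn ℝ ∞ X Ω → ContDiffOn ℝ ∞ Y Ω →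
      (∀ x ∈ Ω, ∃ u, fderiv ℝ F x (X x) = Jt n (fderiv ℝ F x u)) →
      (∀ x ∈ Ω, ∃ u, fderiv ℝ F x (Y x) = Jt n (fderiv ℝ F x u)) →
      ∀ x ∈ Ω, ∃ u, fderiv ℝ F x (VectorField.lieBracket ℝ X Y x) = Jt n (fderiv ℝ F x u))
    {x₀ : E} (hx₀ : x₀ ∈ Ω) :
    ∃ (V : Set (EuclideanSpace ℝ (Fin (2 * n)))) (a b : ℝ)
      (g : EuclideanSpace ℝ (Fin (2 * n)) → Ambient n)
      (ψ : OpenPartialHomeomorph E (EuclideanSpace ℝ (Fin (2 * n)) × ℝ)),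
      IsOpen V ∧ IsParaComplexCentroAffine g V ∧ x₀ ∈ ψ.source ∧ ψ.source ⊆ Ω ∧
      ψ.target = V ×ˢ Ioo a b ∧ ContDiffOn ℝ ∞ ψ ψ.source ∧ ContDiffOn ℝ ∞ ψ.symm ψ.target ∧
      ∀ p ∈ V ×ˢ Ioo a b, F (ψ.symm p) = hyperbolicSweep g p := by
  have hJ : ∀ v, Jt n (Jt n v) = v := Jt_Jt
  obtain ⟨l, ξ, hl, hξ, h⟩ := exists_conormal_reeb hΩ hF himm hF0 htr htan
  choose! hlF hl1 hξF hlr using h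
  let η : E → E →L[ℝ] ℝ := fun x => -(l x ∘L Jt n ∘L fderiv ℝ F x)
  have hηapp : ∀ x v, η x v = -l x (Jt n (fderiv ℝ F x v)) := fun x v => by simp [η]
  have hD : ∀ x ∈ Ω, ∀ v, η x v = 0 ↔ ∃ u, fderiv ℝ F x v = Jt n (fderiv ℝ F x u) := by
    intro x hx v
    rw [hηapp, neg_eq_zero]
    constructor
    · intro h
      obtain ⟨u, hu⟩ := hlr x hx _ h
      exact ⟨u, by rw [hu, hJ]⟩
    · rintro ⟨u, hu⟩
      rw [hu, hJ, hlF x hx]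
  have hηξ : ∀ x ∈ Ω, η x (ξ x) = 1 := fun x hx => by
    rw [hηapp, hξF x hx, map_neg, hJ, map_neg, neg_neg, hl1 x hx]
  obtain ⟨hηsm, hηsymm⟩ := fderiv_contactForm_symmetric hJ hΩ hF hl hξ hlF hl1 hξF hlr
    (η := η) (fun _ => rfl) (fun X Y hX hY hX0 hY0 x hx =>
      (hD x hx _).2 (hinv X Y hX hY (fun y hy => (hD y hy _).1 (hX0 y hy))
        (fun y hy => (hD y hy _).1 (hY0 y hy)) x hx))
  -- The Poincaré lemma is applied on a ball, which is convex.
  obtain ⟨r, hr, hrΩ⟩ := Metric.isOpen_iff.1 hΩ x₀ hx₀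
  have hBo : IsOpen (Metric.ball x₀ r) := Metric.isOpen_ball
  generalize hBdef : Metric.ball x₀ r = B at *
  have hBc : Convex ℝ B := hBdef ▸ convex_ball x₀ r
  have hx₀B : x₀ ∈ B := hBdef ▸ Metric.mem_ball_self hr
  obtain ⟨z, hz⟩ := hBc.exists_forall_hasFDerivAt_of_fderiv_symmetric hBo
    ((hηsm.mono hrΩ).differentiableOn (by simp)) (fun x hx => hηsymm x (hrΩ hx))
  have hzsm : ContDiffOn ℝ ∞ z B := by
    rw [contDiffOn_infty_iff_fderiv_of_isOpen hBo]
    exact ⟨fun x hx => (hz x hx).differentiableAt.differentiableWithinAt,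
      (hηsm.mono hrΩ).congr fun x hx => (hz x hx).fderiv⟩
  let G : E → Ambient n := fun x => Jt n (hypRot (Jt n) (z x) (F x))
  have hGsm : ContDiffOn ℝ ∞ G B :=
    (Jt n).contDiff.comp_contDiffOn
      (((contDiff_hypRot (Jt n)).comp_contDiffOn hzsm).clm_apply (hF.mono hrΩ))
  have hdG : ∀ x ∈ B, ∀ v, fderiv ℝ G x v =
      hypRot (Jt n) (z x) (η x v • F x + Jt n (fderiv ℝ F x v)) := by
    intro x hx v
    have dF : DifferentiableAt ℝ F x :=
      (hF.contDiffAt (hΩ.mem_nhds (hrΩ hx))).differentiableAt (by simp)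
    have h := (Jt n).hasFDerivAt.comp x (HasFDerivAt.hypRot_apply hJ (hz x hx) dF.hasFDerivAt)
    have h2 : HasFDerivAt G _ x := h
    rw [h2.fderiv]
    simp [hJ, map_hypRot]
  have hrotinj : ∀ t w, hypRot (Jt n) t w = 0 → w = 0 := fun t w hw => by
    rw [← hypRot_neg_hypRot hJ t w, hw, map_zero]
  have hGξ : ∀ x ∈ B, fderiv ℝ G x (ξ x) = 0 := fun x hx => by
    rw [hdG x hx, hηξ x (hrΩ hx), hξF x (hrΩ hx), map_neg, hJ, one_smul, add_neg_cancel, map_zero]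
  have hker : ∀ x ∈ B, ∀ v, fderiv ℝ G x v = 0 → ∃ c : ℝ, v = c • ξ x := by
    intro x hx v hv
    rw [hdG x hx] at hv
    have h1 := congrArg (Jt n) (hrotinj _ _ hv)
    rw [map_add, hJ, map_smul, map_zero] at h1
    refine ⟨η x v, himm x (hrΩ hx) ?_⟩
    rw [map_smul, hξF x (hrΩ hx), smul_neg]
    exact (neg_eq_of_add_eq_zero_right h1).symm
  obtain ⟨V, a, b, g, ψ, hV, hxψ, hψB, hψt, hψ, hψs, hg, hGψ, hpt⟩ :=
    exists_straightening hE hBo hGsm hzsm hGξ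
      (fun x hx => by rw [(hz x hx).fderiv, hηξ x (hrΩ hx)]) hker hx₀B
  have hpc : ∀ v ∈ V, Function.Injective (fderiv ℝ g v) ∧
      RestrictsToParaComplex (LinearMap.range (fderiv ℝ g v).toLinearMap) ∧
      LinearIndependent ℝ ![g v, Jt n (g v)] ∧
      IsCompl (LinearMap.range (fderiv ℝ g v).toLinearMap)
        (Submodule.span ℝ {g v, Jt n (g v)}) := by
    intro v hv
    obtain ⟨y, hy, hgy, hinj, hrange⟩ := hpt v hv
    refine ⟨hinj, ?_⟩
    have hyΩ := hrΩ hy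
    let l' : Ambient n →L[ℝ] ℝ := l y ∘L hypRot (Jt n) (-z y) ∘L Jt n
    have hl' : ∀ w, l' w = l y (hypRot (Jt n) (-z y) (Jt n w)) := fun w => rfl
    have hrot : ∀ w, hypRot (Jt n) (-z y) (hypRot (Jt n) (z y) w) = w :=
      hypRot_neg_hypRot hJ (z y)
    apply paraComplex_complement (l := l')
    · intro w
      rw [hrange, hl', hl', hJ]
      constructor
      · rintro ⟨u, rfl⟩
        change l y (hypRot (Jt n) (-z y) (Jt n (fderiv ℝ G y u))) = 0 ∧
          l y (hypRot (Jt n) (-z y) (fderiv ℝ G y u)) = 0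
        rw [← map_hypRot, hdG y hy, hrot, map_add, hJ, map_smul, map_add, map_smul, map_add,
          map_smul, hlF y hyΩ, hl1 y hyΩ, hηapp]
        obtain ⟨q, hq⟩ := htan y hyΩ
        rw [← hq, hlF y hyΩ]
        simp
      -- The first equation makes `R(-z) J̃ w` tangent, equal to `F_* u`; the second says `η u = 0`,
      -- so `dG u = R(z) J̃ F_* u = w`.
      · rintro ⟨h1, h2⟩
        obtain ⟨u, hu⟩ := hlr y hyΩ _ h1
        have hηu : η y u = 0 := by
          rw [hηapp, hu, map_hypRot, hJ, h2, neg_zero]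
        refine ⟨u, ?_⟩
        change fderiv ℝ G y u = w
        rw [hdG y hy, hηu, hu, zero_smul, zero_add, map_hypRot, hJ,
          hypRot_hypRot_neg hJ]
    · rw [hl', hgy]
      change l y (hypRot (Jt n) (-z y) (Jt n (Jt n (hypRot (Jt n) (z y) (F y))))) = 1
      rw [hJ, hrot, hl1 y hyΩ]
    · rw [hl', hgy]
      change l y (hypRot (Jt n) (-z y) (Jt n (Jt n (Jt n (hypRot (Jt n) (z y) (F y)))))) = 0
      obtain ⟨q, hq⟩ := htan y hyΩ
      rw [hJ, map_hypRot, hrot, ← hq, hlF y hyΩ]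
  refine ⟨V, a, b, g, ψ, hV, ⟨hg, fun v hv => (hpc v hv).1, fun v hv => (hpc v hv).2.1,
    fun v hv => (hpc v hv).2.2.1, fun v hv => (hpc v hv).2.2.2⟩, hxψ, hψB.trans hrΩ, hψt, hψ, hψs,
    fun p hp => ?_⟩
  rw [← hψt] at hp
  obtain ⟨h1, h2⟩ := hGψ p hp
  have h3 := hypRot_neg_hypRot hJ p.2 (F (ψ.symm p))
  have h4 : hypRot (Jt n) p.2 (F (ψ.symm p)) = Jt n (g p.1) := by
    rw [← h1, ← h2]
    exact (hJ _).symm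
  rw [h4, hypRot_apply, hJ, Real.cosh_neg, Real.sinh_neg] at h3
  rw [← h3, hyperbolicSweep, neg_smul, sub_eq_add_neg]

end ParaComplex

/-! ### Transfer of part (a) to a manifold through a chart. -/

namespace ParaComplex

theorem mlieBracket_eq_lieBracket {E : Type*} [NormedAddCommGroup E] [NormedSpace ℝ E]
    (X Y : (x : E) → TangentSpace 𝓘(ℝ, E) x) :
    VectorField.mlieBracket 𝓘(ℝ, E) X Y = VectorField.lieBracket ℝ X Y := by
  rw [← VectorField.mlieBracketWithin_univ, VectorField.mlieBracketWithin_eq_lieBracketWithin]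
  exact VectorField.lieBracketWithin_univ (V := fun x : E => (X x : E)) (W := fun x : E => (Y x : E))

theorem mem_distributionD_iff {E : Type*} [NormedAddCommGroup E] [NormedSpace ℝ E] {M : Type*}
    [TopologicalSpace M] [ChartedSpace E M] {n : ℕ} {f : M → Ambient n} {x : M}
    {v : TangentSpace 𝓘(ℝ, E) x} :
    v ∈ distributionD E f x ↔ ∃ u, pushforward E f x v = Jt n (pushforward E f x u) := by
  rw [distributionD, Submodule.mem_comap, Submodule.mem_inf]
  constructor
  · rintro ⟨_, _, ⟨u, rfl⟩, hu⟩
    exact ⟨u, hu.symm⟩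
  · rintro ⟨u, hu⟩
    exact ⟨⟨v, rfl⟩, _, ⟨u, rfl⟩, hu.symm⟩

section Chart

variable {E : Type*} [NormedAddCommGroup E] [NormedSpace ℝ E]
  {M : Type*} [TopologicalSpace M] [ChartedSpace E M] [IsManifold 𝓘(ℝ, E) ∞ M] {n : ℕ}

/-- The differential of a map read in a chart factors through the invertible differential of the
inverse chart. -/
theorem exists_fderiv_comp_chart_symm {f : M → Ambient n}
    (hf : ContMDiff 𝓘(ℝ, E) 𝓘(ℝ, Ambient n) ∞ f) (x : M) {y : E} (hy : y ∈ (chartAt E x).target) :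
    ∃ S : E ≃L[ℝ] TangentSpace 𝓘(ℝ, E) ((chartAt E x).symm y),
      (S.symm : TangentSpace 𝓘(ℝ, E) ((chartAt E x).symm y) →L[ℝ] E) =
        mfderiv 𝓘(ℝ, E) 𝓘(ℝ, E) (chartAt E x) ((chartAt E x).symm y) ∧
      ∀ v, fderiv ℝ (f ∘ (chartAt E x).symm) y v =
        pushforward E f ((chartAt E x).symm y) (S v) := by
  have : IsManifold 𝓘(ℝ, E) 1 M := IsManifold.of_le (n := ∞) (by simp)
  have hc := mdifferentiable_chart (I := 𝓘(ℝ, E)) x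
  have hs : (chartAt E x).symm y ∈ (chartAt E x).source := (chartAt E x).map_target hy
  have h1 := hc.symm.mdifferentiableAt (x := y) hy
  have hfd := (hf ((chartAt E x).symm y)).mdifferentiableAt (by simp)
  have h2 := mfderiv_comp y hfd h1
  have hA := hc.symm_comp_deriv hs
  have hB := hc.comp_symm_deriv hy
  rw [(chartAt E x).right_inv hy] at hA
  refine ⟨ContinuousLinearEquiv.equivOfInverse
    (mfderiv 𝓘(ℝ, E) 𝓘(ℝ, E) (chartAt E x).symm y)
    (mfderiv 𝓘(ℝ, E) 𝓘(ℝ, E) (chartAt E x) ((chartAt E x).symm y))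
    (fun v => congrArg (fun T : E →L[ℝ] E => T v) hB)
    (fun v => congrArg (fun T : E →L[ℝ] E => T v) hA), rfl, fun v => ?_⟩
  rw [← mfderiv_eq_fderiv, h2]
  rfl

/-- All hypotheses are pointwise conditions on `f_*` and pass to `f ∘ chart⁻¹`, except involutivity:
fields on the chart target are pulled back to the chart source, where naturality of the Lie bracket
under pullback applies. -/
theorem exists_sweep_coordinates_of_involutive [FiniteDimensional ℝ E]
    (hE : finrank ℝ E = 2 * n + 1) {f : M → Ambient n} (hf : IsImmersedOn E f univ)
    (htr : IsTransversalOn E f (fun x => -f x) univ)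
    (htan : IsJtTangentOn E f (fun x => -f x) univ)
    (hinv : IsInvolutiveOn E (distributionD E f) univ) (x : M) :
    ∃ (V : Set (EuclideanSpace ℝ (Fin (2 * n)))) (a b : ℝ)
      (g : EuclideanSpace ℝ (Fin (2 * n)) → Ambient n)
      (ψ : OpenPartialHomeomorph M (EuclideanSpace ℝ (Fin (2 * n)) × ℝ)),
      IsOpen V ∧ IsParaComplexCentroAffine g V ∧
      x ∈ ψ.source ∧ ψ.target = V ×ˢ Ioo a b ∧
      ContMDiffOn 𝓘(ℝ, E) 𝓘(ℝ, EuclideanSpace ℝ (Fin (2 * n)) × ℝ) ∞ ψ ψ.source ∧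
      ContMDiffOn 𝓘(ℝ, EuclideanSpace ℝ (Fin (2 * n)) × ℝ) 𝓘(ℝ, E) ∞ ψ.symm ψ.target ∧
      ∀ p ∈ V ×ˢ Ioo a b, f (ψ.symm p) = hyperbolicSweep g p := by
  have : IsManifold 𝓘(ℝ, E) 1 M := IsManifold.of_le (n := ∞) (by simp)
  have : IsManifold 𝓘(ℝ, E) (minSmoothness ℝ 3) M := IsManifold.of_le (n := ∞) (by
    rw [minSmoothness_of_isRCLikeNormedField]; exact WithTop.coe_le_coe.2 (le_top : (3 : ℕ∞) ≤ ⊤))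
  have hfs : ContMDiff 𝓘(ℝ, E) 𝓘(ℝ, Ambient n) ∞ f := contMDiffOn_univ.1 hf.1
  have hcs : ContMDiffOn 𝓘(ℝ, E) 𝓘(ℝ, E) ∞ (chartAt E x) (chartAt E x).source :=
    contMDiffOn_chart
  have hcs' : ContMDiffOn 𝓘(ℝ, E) 𝓘(ℝ, E) ∞ (chartAt E x).symm (chartAt E x).target :=
    contMDiffOn_chart_symm
  have hS := fun y hy => exists_fderiv_comp_chart_symm (n := n) hfs x (y := y) hy
  choose S hSsymm hSf using hS
  have hrange : ∀ y (hy : y ∈ (chartAt E x).target),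
      LinearMap.range (fderiv ℝ (f ∘ (chartAt E x).symm) y).toLinearMap =
        LinearMap.range (pushforward E f ((chartAt E x).symm y)) := by
    intro y hy
    ext w
    constructor
    · rintro ⟨v, rfl⟩
      exact ⟨S y hy v, (hSf y hy v).symm⟩
    · rintro ⟨v, rfl⟩
      refine ⟨(S y hy).symm v, (hSf y hy _).trans ?_⟩
      rw [ContinuousLinearEquiv.apply_symm_apply]
  have hD : ∀ y (hy : y ∈ (chartAt E x).target) v,
      S y hy v ∈ distributionD E f ((chartAt E x).symm y) ↔
        ∃ u, fderiv ℝ (f ∘ (chartAt E x).symm) y v =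
          Jt n (fderiv ℝ (f ∘ (chartAt E x).symm) y u) := by
    intro y hy v
    rw [mem_distributionD_iff, hSf y hy]
    constructor
    · rintro ⟨u, hu⟩
      exact ⟨(S y hy).symm u, by rw [hSf y hy, ContinuousLinearEquiv.apply_symm_apply, hu]⟩
    · rintro ⟨u, hu⟩
      exact ⟨S y hy u, by rw [hu, hSf y hy]⟩
  obtain ⟨V, a, b, g, ψ, hV, hg, hxψ, hψs, hψt, hψ, hψ', hfg⟩ :=
    exists_hyperbolicSweep_coordinates (n := n) hE (F := f ∘ (chartAt E x).symm)
      (Ω := (chartAt E x).target) (chartAt E x).open_target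
      (contMDiffOn_iff_contDiffOn.1 (hfs.comp_contMDiffOn hcs'))
      (fun y hy u v huv => (S y hy).injective (hf.2 _ trivial (by
        rw [← hSf, ← hSf]; exact huv)))
      (fun y hy => neg_ne_zero.1 (htr.2 ((chartAt E x).symm y) trivial).1)
      (fun y hy => by
        have h := (htr.2 ((chartAt E x).symm y) trivial).2
        rw [hrange y hy]
        have hs : Submodule.span ℝ {-f ((chartAt E x).symm y)} =
            Submodule.span ℝ {(f ∘ (chartAt E x).symm) y} := by
          rw [← Set.neg_singleton, Submodule.span_neg]; rfl
        rwa [hs] at h)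
      (fun y hy => by
        have h := htan ((chartAt E x).symm y) trivial
        rw [← hrange y hy] at h
        obtain ⟨v, hv⟩ := h
        refine ⟨-v, ?_⟩
        rw [map_neg]
        refine neg_eq_iff_eq_neg.2 (hv.trans ?_)
        rw [map_neg]
        rfl)
      (fun X Y hX hY hXD hYD y hy => by
        have hmem : ∀ q ∈ (chartAt E x).source, chartAt E x q ∈ (chartAt E x).target :=
          fun q hq => (chartAt E x).map_source hq
        have hcAt : ∀ q ∈ (chartAt E x).source,
            ContMDiffAt 𝓘(ℝ, E) 𝓘(ℝ, E) ∞ (chartAt E x) q := fun q hq =>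
          hcs.contMDiffAt ((chartAt E x).open_source.mem_nhds hq)
        have hpull : ∀ y (hy : y ∈ (chartAt E x).target) (W : E → E),
            VectorField.mpullback 𝓘(ℝ, E) 𝓘(ℝ, E) (chartAt E x) W ((chartAt E x).symm y) =
              S y hy (W y) := by
          intro y hy W
          have hi : (mfderiv 𝓘(ℝ, E) 𝓘(ℝ, E) (chartAt E x) ((chartAt E x).symm y)).inverse =
              (S y hy : E →L[ℝ] TangentSpace 𝓘(ℝ, E) ((chartAt E x).symm y)) :=
            (congrArg ContinuousLinearMap.inverse (hSsymm y hy).symm).trans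
              (ContinuousLinearMap.inverse_equiv (S y hy).symm)
          exact (congrArg (fun T : E →L[ℝ] E => T (W (chartAt E x ((chartAt E x).symm y)))) hi).trans
            (congrArg (fun q => S y hy (W q)) ((chartAt E x).right_inv hy))
        have hsm : ∀ W : E → E, ContDiffOn ℝ ∞ W (chartAt E x).target →
            IsSmoothFieldOn E (VectorField.mpullback 𝓘(ℝ, E) 𝓘(ℝ, E) (chartAt E x) W)
              (chartAt E x).source := by
          intro W hW q hq
          have h1 : ContDiffAt ℝ ∞ W (chartAt E x q) :=
            hW.contDiffAt ((chartAt E x).open_target.mem_nhds (hmem q hq))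
          exact (ContMDiffAt.mpullback_vectorField_preimage
            (contMDiffAt_vectorSpace_iff_contDiffAt.2 h1) (hcAt q hq)
            ⟨(mdifferentiable_chart (I := 𝓘(ℝ, E)) x).mfderiv hq, rfl⟩
            (by simp)).contMDiffWithinAt
        have hsec : ∀ W : E → E, (∀ y ∈ (chartAt E x).target,
            ∃ u, fderiv ℝ (f ∘ (chartAt E x).symm) y (W y) =
              Jt n (fderiv ℝ (f ∘ (chartAt E x).symm) y u)) → ∀ q ∈ (chartAt E x).source,
            VectorField.mpullback 𝓘(ℝ, E) 𝓘(ℝ, E) (chartAt E x) W q ∈ distributionD E f q := by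
          intro W hW q hq
          have h := (hD _ (hmem q hq) _).2 (hW _ (hmem q hq))
          rw [← hpull _ (hmem q hq), (chartAt E x).left_inv hq] at h
          exact h
        have hq : (chartAt E x).symm y ∈ (chartAt E x).source := (chartAt E x).map_target hy
        have hbr := hinv (chartAt E x).source (chartAt E x).open_source (subset_univ _) _ _
          (hsm X hX) (hsm Y hY) (hsec X hXD) (hsec Y hYD) _ hq
        have hmd : ∀ W : E → E, ContDiffOn ℝ ∞ W (chartAt E x).target →
            MDifferentiableAt 𝓘(ℝ, E) 𝓘(ℝ, E).tangent
              (fun p => (⟨p, W p⟩ : TangentBundle 𝓘(ℝ, E) E))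
              (chartAt E x ((chartAt E x).symm y)) := by
          intro W hW
          have h1 : ContDiffAt ℝ ∞ W (chartAt E x ((chartAt E x).symm y)) :=
            hW.contDiffAt ((chartAt E x).open_target.mem_nhds (hmem _ hq))
          exact (contMDiffAt_vectorSpace_iff_contDiffAt.2 h1).mdifferentiableAt (by simp)
        rw [← VectorField.mpullback_mlieBracket (hmd X hX) (hmd Y hY) (hcAt _ hq) (by
          rw [minSmoothness_of_isRCLikeNormedField]
          exact WithTop.coe_le_coe.2 (le_top : (2 : ℕ∞) ≤ ⊤))] at hbr
        have h := (hD y hy _).1 (hpull y hy (VectorField.mlieBracket 𝓘(ℝ, E) X Y) ▸ hbr)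
        exact mlieBracket_eq_lieBracket X Y ▸ h)
      (mem_chart_target E x)
  have hss : ((chartAt E x).trans ψ).source ⊆ (chartAt E x).source := fun q hq => hq.1
  have htt : ((chartAt E x).trans ψ).target = ψ.target := by
    rw [OpenPartialHomeomorph.trans_target]
    exact inter_eq_left.2 fun p hp => hψs (ψ.map_target hp)
  refine ⟨V, a, b, g, (chartAt E x).trans ψ, hV, hg, ⟨mem_chart_source E x, hxψ⟩, htt.trans hψt,
    ?_, ?_, hfg⟩
  · exact (contMDiffOn_iff_contDiffOn.2 hψ).comp (hcs.mono hss) fun q hq => hq.2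
  · rw [htt]
    exact hcs'.comp (contMDiffOn_iff_contDiffOn.2 hψ') fun p hp => hψs (ψ.map_target hp)

end Chart

end ParaComplex

/-! ### The sweep of a para-complex centro-affine immersion, for part (b). -/

namespace ParaComplex

theorem hyperbolicSweep_eq_hypRot {n : ℕ} (g : EuclideanSpace ℝ (Fin (2 * n)) → Ambient n)
    (p : EuclideanSpace ℝ (Fin (2 * n)) × ℝ) :
    hyperbolicSweep g p = hypRot (Jt n) (-p.2) (Jt n (g p.1)) := by
  rw [hyperbolicSweep, hypRot_apply, Jt_Jt, Real.cosh_neg, Real.sinh_neg, neg_smul,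
    sub_eq_add_neg]

namespace IsParaComplexCentroAffine

variable {n : ℕ} {g : EuclideanSpace ℝ (Fin (2 * n)) → Ambient n}
  {V : Set (EuclideanSpace ℝ (Fin (2 * n)))}

theorem exists_fderiv_eq_Jt (hg : IsParaComplexCentroAffine g V)
    {y : EuclideanSpace ℝ (Fin (2 * n))} (hy : y ∈ V) (v : EuclideanSpace ℝ (Fin (2 * n))) :
    ∃ u, fderiv ℝ g y u = Jt n (fderiv ℝ g y v) :=
  (hg.paraHolomorphic y hy).1 _ ⟨v, rfl⟩

theorem exists_decomposition (hg : IsParaComplexCentroAffine g V)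
    {y : EuclideanSpace ℝ (Fin (2 * n))} (hy : y ∈ V) (w : Ambient n) :
    ∃ (v : EuclideanSpace ℝ (Fin (2 * n))) (a b : ℝ),
      w = fderiv ℝ g y v + (a • g y + b • Jt n (g y)) := by
  have hw : w ∈ LinearMap.range (fderiv ℝ g y).toLinearMap ⊔
      Submodule.span ℝ {g y, Jt n (g y)} := by
    rw [(hg.transversal y hy).sup_eq_top]; trivial
  obtain ⟨_, ⟨v, rfl⟩, _, hs, rfl⟩ := Submodule.mem_sup.1 hw
  obtain ⟨a, b, rfl⟩ := Submodule.mem_span_pair.1 hs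
  exact ⟨v, a, b, rfl⟩

theorem eq_zero_of_decomposition (hg : IsParaComplexCentroAffine g V)
    {y : EuclideanSpace ℝ (Fin (2 * n))} (hy : y ∈ V) {v : EuclideanSpace ℝ (Fin (2 * n))}
    {a b : ℝ} (h : fderiv ℝ g y v + (a • g y + b • Jt n (g y)) = 0) : v = 0 ∧ a = 0 ∧ b = 0 := by
  have h1 : fderiv ℝ g y v = 0 := Submodule.disjoint_def.1 (hg.transversal y hy).disjoint _
    ⟨v, rfl⟩ (by
      rw [eq_neg_of_add_eq_zero_left h]
      exact Submodule.neg_mem _ (Submodule.mem_span_pair.2 ⟨a, b, rfl⟩))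
  rw [h1, zero_add] at h
  exact ⟨(injective_iff_map_eq_zero _).1 (hg.immersion y hy) v h1,
    LinearIndependent.pair_iff.1 (hg.independent y hy) a b h⟩

theorem hasFDerivAt (hg : IsParaComplexCentroAffine g V) (hV : IsOpen V)
    {y : EuclideanSpace ℝ (Fin (2 * n))} (hy : y ∈ V) : HasFDerivAt g (fderiv ℝ g y) y :=
  ((hg.smooth.contDiffAt (hV.mem_nhds hy)).differentiableAt (by simp)).hasFDerivAt

/-- The angle derivative of `R(-z) (J̃ g)` is `-R(-z) g`, because `J̃² = id`. The proofs below apply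
`R(z)` and compare components in the splitting by `g_*`, `g` and `J̃ g`. -/
theorem pushforward_hyperbolicSweep (hg : IsParaComplexCentroAffine g V) (hV : IsOpen V)
    {p : EuclideanSpace ℝ (Fin (2 * n)) × ℝ} (hp : p ∈ V ×ˢ (univ : Set ℝ))
    (w : EuclideanSpace ℝ (Fin (2 * n)) × ℝ) :
    pushforward (EuclideanSpace ℝ (Fin (2 * n)) × ℝ) (hyperbolicSweep g) p w =
      hypRot (Jt n) (-p.2) (Jt n (fderiv ℝ g p.1 w.1) - w.2 • g p.1) := by
  have h1 : HasFDerivAt (fun p : EuclideanSpace ℝ (Fin (2 * n)) × ℝ => -p.2) _ p :=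
    (hasFDerivAt_snd (𝕜 := ℝ) (p := p)).neg
  have h2 : HasFDerivAt (fun p : EuclideanSpace ℝ (Fin (2 * n)) × ℝ => Jt n (g p.1)) _ p :=
    (Jt n).hasFDerivAt.comp p ((hg.hasFDerivAt hV hp.1).comp p hasFDerivAt_fst)
  have h := HasFDerivAt.hypRot_apply Jt_Jt h1 h2
  have h3 : hyperbolicSweep g = fun p => hypRot (Jt n) (-p.2) (Jt n (g p.1)) :=
    funext (hyperbolicSweep_eq_hypRot g)
  have h4 : pushforward (EuclideanSpace ℝ (Fin (2 * n)) × ℝ) (hyperbolicSweep g) p w =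
      fderiv ℝ (hyperbolicSweep g) p w := by
    rw [← mfderiv_eq_fderiv]; rfl
  rw [h4, h3, h.fderiv]
  simp [map_hypRot, Jt_Jt, sub_eq_neg_add]

theorem contDiffOn_hyperbolicSweep (hg : IsParaComplexCentroAffine g V) :
    ContDiffOn ℝ ∞ (hyperbolicSweep g) (V ×ˢ univ) := by
  have h1 : ContDiffOn ℝ ∞ (fun p : EuclideanSpace ℝ (Fin (2 * n)) × ℝ => g p.1) (V ×ˢ univ) :=
    hg.smooth.comp contDiffOn_fst fun p hp => hp.1
  exact ((Real.contDiff_cosh.comp contDiff_snd).contDiffOn.smul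
    ((Jt n).contDiff.comp_contDiffOn h1)).sub
    ((Real.contDiff_sinh.comp contDiff_snd).contDiffOn.smul h1)

theorem isImmersedOn_hyperbolicSweep (hg : IsParaComplexCentroAffine g V) (hV : IsOpen V) :
    IsImmersedOn (EuclideanSpace ℝ (Fin (2 * n)) × ℝ) (hyperbolicSweep g) (V ×ˢ univ) := by
  refine ⟨contMDiffOn_iff_contDiffOn.2 hg.contDiffOn_hyperbolicSweep, fun p hp => ?_⟩
  refine (injective_iff_map_eq_zero _).2 fun (w : EuclideanSpace ℝ (Fin (2 * n)) × ℝ) hw => ?_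
  have h := (hg.pushforward_hyperbolicSweep hV hp w).symm.trans hw
  have h1 := congrArg (hypRot (Jt n) (- -p.2)) h
  obtain ⟨u, hu⟩ := hg.exists_fderiv_eq_Jt hp.1 w.1
  rw [hypRot_neg_hypRot Jt_Jt, map_zero, ← hu] at h1
  obtain ⟨h2, h3, _⟩ := hg.eq_zero_of_decomposition hp.1 (v := u) (a := -w.2) (b := 0)
    (by rw [← h1]; module)
  rw [h2, map_zero] at hu
  have h4 : fderiv ℝ g p.1 w.1 = 0 := by rw [← Jt_Jt (fderiv ℝ g p.1 w.1), ← hu, map_zero]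
  exact Prod.ext ((injective_iff_map_eq_zero _).1 (hg.immersion _ hp.1) _ h4) (neg_eq_zero.1 h3)

theorem isTransversalOn_hyperbolicSweep (hg : IsParaComplexCentroAffine g V) (hV : IsOpen V) :
    IsTransversalOn (EuclideanSpace ℝ (Fin (2 * n)) × ℝ) (hyperbolicSweep g)
      (fun p => -hyperbolicSweep g p) (V ×ˢ univ) := by
  refine ⟨contMDiffOn_iff_contDiffOn.2 hg.contDiffOn_hyperbolicSweep.neg, fun p hp => ⟨?_, ?_, ?_⟩⟩
  · intro h
    beta_reduce at h
    rw [hyperbolicSweep_eq_hypRot, neg_eq_zero] at h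
    have h1 := congrArg (hypRot (Jt n) (- -p.2)) h
    rw [hypRot_neg_hypRot Jt_Jt, map_zero] at h1
    have h2 := (hg.eq_zero_of_decomposition hp.1 (v := 0) (a := 0) (b := 1) (by simp [h1])).2.2
    exact one_ne_zero h2
  · rw [Submodule.disjoint_def]
    rintro _ ⟨(w : EuclideanSpace ℝ (Fin (2 * n)) × ℝ), rfl⟩ hs
    obtain ⟨c, hc⟩ := Submodule.mem_span_singleton.1 hs
    have h := hc.trans (hg.pushforward_hyperbolicSweep hV hp w)
    beta_reduce at h
    rw [hyperbolicSweep_eq_hypRot] at h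
    have h1 := congrArg (hypRot (Jt n) (- -p.2)) h
    obtain ⟨u, hu⟩ := hg.exists_fderiv_eq_Jt hp.1 w.1
    rw [map_smul, map_neg, hypRot_neg_hypRot Jt_Jt, hypRot_neg_hypRot Jt_Jt, ← hu] at h1
    have h2 := (hg.eq_zero_of_decomposition hp.1 (v := u) (a := -w.2) (b := c)
      (by
        have h3 : c • Jt n (g p.1) = -(fderiv ℝ g p.1 u - w.2 • g p.1) := by
          rw [← h1, smul_neg, neg_neg]
        rw [h3]; module)).2.2
    rw [← hc, h2, zero_smul]
  · rw [codisjoint_iff, eq_top_iff]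
    intro w _
    obtain ⟨v, a, b, h⟩ := hg.exists_decomposition hp.1 (hypRot (Jt n) (- -p.2) w)
    obtain ⟨u, hu⟩ := hg.exists_fderiv_eq_Jt hp.1 v
    -- If `R(z) w = g_* v + a g + b J̃ g` and `g_* u = J̃ g_* v`, then `w = f_*(u, -a) + b f`.
    refine Submodule.mem_sup.2 ⟨_,
      ⟨((u, -a) : EuclideanSpace ℝ (Fin (2 * n)) × ℝ), rfl⟩, (-b) • -hyperbolicSweep g p,
      Submodule.smul_mem _ _ (Submodule.mem_span_singleton_self _), ?_⟩
    refine (congrArg (· + (-b) • -hyperbolicSweep g p)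
      (hg.pushforward_hyperbolicSweep hV hp (u, -a))).trans ?_
    change hypRot (Jt n) (-p.2) (Jt n (fderiv ℝ g p.1 u) - (-a) • g p.1) +
      (-b) • -hyperbolicSweep g p = w
    rw [hyperbolicSweep_eq_hypRot, hu, Jt_Jt, neg_smul_neg, ← map_smul, ← map_add]
    have h1 : fderiv ℝ g p.1 v - (-a) • g p.1 + b • Jt n (g p.1) =
        hypRot (Jt n) (- -p.2) w := by rw [h]; module
    rw [h1, hypRot_hypRot_neg Jt_Jt]

theorem isJtTangentOn_hyperbolicSweep (hg : IsParaComplexCentroAffine g V) (hV : IsOpen V) :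
    IsJtTangentOn (EuclideanSpace ℝ (Fin (2 * n)) × ℝ) (hyperbolicSweep g)
      (fun p => -hyperbolicSweep g p) (V ×ˢ univ) := by
  intro p hp
  refine ⟨((0, 1) : EuclideanSpace ℝ (Fin (2 * n)) × ℝ), ?_⟩
  refine (hg.pushforward_hyperbolicSweep hV hp (0, 1)).trans ?_
  beta_reduce
  rw [hyperbolicSweep_eq_hypRot, map_neg, map_hypRot, Jt_Jt]
  simp

/-- After unrotating, the tangent space of the sweep is `g_* ⊕ span g` and its `J̃`-image is `g_* ⊕
span (J̃ g)`; they meet in `g_*`, where the `z`-component vanishes. -/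
theorem mem_distributionD_hyperbolicSweep_iff (hg : IsParaComplexCentroAffine g V) (hV : IsOpen V)
    {p : EuclideanSpace ℝ (Fin (2 * n)) × ℝ} (hp : p ∈ V ×ˢ (univ : Set ℝ))
    (w : EuclideanSpace ℝ (Fin (2 * n)) × ℝ) :
    w ∈ distributionD (EuclideanSpace ℝ (Fin (2 * n)) × ℝ) (hyperbolicSweep g) p ↔ w.2 = 0 := by
  refine mem_distributionD_iff.trans ⟨?_, fun h => ?_⟩
  · rintro ⟨(q : EuclideanSpace ℝ (Fin (2 * n)) × ℝ), hq⟩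
    have h := ((hg.pushforward_hyperbolicSweep hV hp w).symm.trans hq).trans
      (congrArg (Jt n) (hg.pushforward_hyperbolicSweep hV hp q))
    rw [map_hypRot, map_sub (Jt n), Jt_Jt, map_smul (Jt n)] at h
    have h1 := congrArg (hypRot (Jt n) (- -p.2)) h
    obtain ⟨u, hu⟩ := hg.exists_fderiv_eq_Jt hp.1 w.1
    rw [hypRot_neg_hypRot Jt_Jt, hypRot_neg_hypRot Jt_Jt, ← hu] at h1
    have h2 := (hg.eq_zero_of_decomposition hp.1 (v := u - q.1) (a := -w.2) (b := q.2)
      (by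
        rw [map_sub, ← sub_eq_zero.2 h1]
        module)).2.1
    exact neg_eq_zero.1 h2
  · obtain ⟨u, hu⟩ := hg.exists_fderiv_eq_Jt hp.1 w.1
    refine ⟨((u, 0) : EuclideanSpace ℝ (Fin (2 * n)) × ℝ), ?_⟩
    refine (hg.pushforward_hyperbolicSweep hV hp w).trans (Eq.trans ?_
      (congrArg (Jt n) (hg.pushforward_hyperbolicSweep hV hp (u, 0))).symm)
    change _ = Jt n (hypRot (Jt n) (-p.2) (Jt n (fderiv ℝ g p.1 u) - (0 : ℝ) • g p.1))
    rw [hu, Jt_Jt, h, zero_smul, sub_zero, sub_zero, map_hypRot]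

theorem isInvolutiveOn_hyperbolicSweep (hg : IsParaComplexCentroAffine g V) (hV : IsOpen V) :
    IsInvolutiveOn (EuclideanSpace ℝ (Fin (2 * n)) × ℝ)
      (distributionD (EuclideanSpace ℝ (Fin (2 * n)) × ℝ) (hyperbolicSweep g)) (V ×ˢ univ) := by
  intro O hO hOV X Y hX hY hXD hYD p hp
  rw [mlieBracket_eq_lieBracket]
  refine (hg.mem_distributionD_hyperbolicSweep_iff hV (hOV hp) _).2 ?_
  have key : ∀ W : EuclideanSpace ℝ (Fin (2 * n)) × ℝ → EuclideanSpace ℝ (Fin (2 * n)) × ℝ,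
      ContDiffOn ℝ ∞ W O → (∀ q ∈ O, (W q).2 = 0) → ∀ u, (fderiv ℝ W p u).2 = 0 := by
    intro W hW hW0 u
    have h1 : HasFDerivAt W (fderiv ℝ W p) p :=
      ((hW.contDiffAt (hO.mem_nhds hp)).differentiableAt (by simp)).hasFDerivAt
    have h2 : HasFDerivAt (fun q => (W q).2) (0 : _ →L[ℝ] ℝ) p :=
      (hasFDerivAt_const (0 : ℝ) p).congr_of_eventuallyEq
        (Filter.eventually_of_mem (hO.mem_nhds hp) hW0)
    exact congrArg (fun T : _ →L[ℝ] ℝ => T u) (h1.snd.unique h2)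
  have hX0 := key X (contMDiffOn_vectorSpace_iff_contDiffOn.1 hX) fun q hq =>
    (hg.mem_distributionD_hyperbolicSweep_iff hV (hOV hq) _).1 (hXD q hq)
  have hY0 := key Y (contMDiffOn_vectorSpace_iff_contDiffOn.1 hY) fun q hq =>
    (hg.mem_distributionD_hyperbolicSweep_iff hV (hOV hq) _).1 (hYD q hq)
  exact sub_eq_zero.2 ((hY0 (X p)).trans (hX0 (Y p)).symm)

theorem isNondegenerateOn_hyperbolicSweep (hg : IsParaComplexCentroAffine g V) (hV : IsOpen V)
    (hnd : IsParaNondegenerate g V) :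
    IsNondegenerateOn (EuclideanSpace ℝ (Fin (2 * n)) × ℝ) (hyperbolicSweep g)
      (fun p => -hyperbolicSweep g p) (V ×ˢ univ) := by
  obtain ⟨h₁, h₂, hgauss, hnd⟩ := hnd
  let h : EuclideanSpace ℝ (Fin (2 * n)) × ℝ →
      LinearMap.BilinForm ℝ (EuclideanSpace ℝ (Fin (2 * n)) × ℝ) := fun p =>
    -((h₁ p.1).compl₁₂ (LinearMap.fst ℝ _ ℝ) (LinearMap.fst ℝ _ ℝ) +
      (LinearMap.mul ℝ ℝ).compl₁₂ (LinearMap.snd ℝ _ ℝ) (LinearMap.snd ℝ _ ℝ))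
  have happ : ∀ p v w, h p v w = -(h₁ p.1 v.1 w.1 + v.2 * w.2) := fun p v w => rfl
  refine ⟨h, ?_, fun p hp => ⟨?_, ?_⟩⟩
  · intro O hO hOV (Y : EuclideanSpace ℝ (Fin (2 * n)) × ℝ → EuclideanSpace ℝ (Fin (2 * n)) × ℝ)
      hYs p hp (X : EuclideanSpace ℝ (Fin (2 * n)) × ℝ)
    have hpV : p.1 ∈ V := (hOV hp).1
    have hY : HasFDerivAt Y (fderiv ℝ Y p) p :=
      (((contMDiffOn_vectorSpace_iff_contDiffOn.1 hYs).contDiffAt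
        (hO.mem_nhds hp)).differentiableAt (by simp)).hasFDerivAt
    have hdg : HasFDerivAt (fderiv ℝ g) (fderiv ℝ (fderiv ℝ g) p.1) p.1 :=
      (((hg.smooth.fderiv_of_isOpen hV (m := ∞) (by simp)).contDiffAt
        (hV.mem_nhds hpV)).differentiableAt (by simp)).hasFDerivAt
    -- A constant field suffices, since Gauss's formula then computes `D²g(X, Y)`; the derivative of
    -- the actual field contributes only tangential terms.
    obtain ⟨Z, hZ⟩ := hgauss V hV subset_rfl (fun _ => (Y p).1) contDiffOn_const p.1 hpV X.1
    rw [(hdg.clm_apply (hasFDerivAt_const (Y p).1 p.1)).fderiv] at hZ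
    obtain ⟨k, hk⟩ := hg.exists_fderiv_eq_Jt hpV (X.2 • (Y p).1 + (Y p).2 • X.1)
    let DY := fderiv ℝ Y p X
    -- After unrotating, the `J̃ g`-component of the derivative is `h₁ + X.2 Y.2`, the coefficient
    -- of `f`. The `g`-component `h₂ - DY.2` goes into the last coordinate with opposite sign, and
    -- `k` absorbs the mixed terms `X.2 g_* Y.1 + Y.2 g_* X.1`.
    refine ⟨((Z + DY.1 - k, DY.2 - h₂ p.1 X.1 (Y p).1) : EuclideanSpace ℝ (Fin (2 * n)) × ℝ), ?_⟩
    have hl : HasFDerivAt (fun q => pushforward (EuclideanSpace ℝ (Fin (2 * n)) × ℝ)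
        (hyperbolicSweep g) q (Y q)) _ p :=
      (HasFDerivAt.hypRot_apply Jt_Jt (hasFDerivAt_snd (𝕜 := ℝ) (p := p)).neg
        (((Jt n).hasFDerivAt.comp p ((hdg.comp p hasFDerivAt_fst).clm_apply hY.fst)).sub
          (hY.snd.smul ((hg.hasFDerivAt hV hpV).comp p hasFDerivAt_fst)))).congr_of_eventuallyEq
        (Filter.eventually_of_mem (hO.mem_nhds hp) fun q hq =>
          hg.pushforward_hyperbolicSweep hV (hOV hq) (Y q))
    have hl' : pushforward (EuclideanSpace ℝ (Fin (2 * n)) × ℝ)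
        (fun q => pushforward (EuclideanSpace ℝ (Fin (2 * n)) × ℝ)
          (hyperbolicSweep g) q (Y q)) p X = fderiv ℝ (fun q =>
            pushforward (EuclideanSpace ℝ (Fin (2 * n)) × ℝ) (hyperbolicSweep g) q (Y q)) p X := by
      rw [← mfderiv_eq_fderiv]; rfl
    refine hl'.trans ?_
    rw [hl.fderiv]
    refine Eq.trans ?_ (congrArg (· + h p X (Y p) • -hyperbolicSweep g p)
      (hg.pushforward_hyperbolicSweep hV (hOV hp) _).symm)
    beta_reduce
    rw [hyperbolicSweep_eq_hypRot, happ]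
    have hZ' : fderiv ℝ (fderiv ℝ g) p.1 X.1 (Y p).1 = fderiv ℝ g p.1 Z +
        h₁ p.1 X.1 (Y p).1 • g p.1 + h₂ p.1 X.1 (Y p).1 • Jt n (g p.1) := by
      simpa using hZ
    simp [DY, hZ', hk, map_hypRot, Jt_Jt]
    module
  · intro (v : EuclideanSpace ℝ (Fin (2 * n)) × ℝ) hv
    refine Prod.ext ((hnd p.1 hp.1).1 v.1 fun w => ?_) ?_
    · simpa using (happ p v (w, 0)).symm.trans (hv _)
    · change v.2 = 0
      simpa using (happ p v (0, 1)).symm.trans (hv _)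
  · intro (v : EuclideanSpace ℝ (Fin (2 * n)) × ℝ) hv
    refine Prod.ext ((hnd p.1 hp.1).2 v.1 fun w => ?_) ?_
    · simpa using (happ p (w, 0) v).symm.trans (hv _)
    · change v.2 = 0
      simpa using (happ p (0, 1) v).symm.trans (hv _)

end IsParaComplexCentroAffine

end ParaComplex

/-! ### The theorem. -/

open ParaComplex in
theorem mainTheorem4 (n : ℕ) :
    (∀ (M : Type*) [TopologicalSpace M] [ChartedSpace (EuclideanSpace ℝ (Fin (2 * n + 1))) M]
        [IsManifold 𝓘(ℝ, EuclideanSpace ℝ (Fin (2 * n + 1))) ∞ M] (f : M → Ambient n),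
        IsImmersedOn (EuclideanSpace ℝ (Fin (2 * n + 1))) f univ →
        IsTransversalOn (EuclideanSpace ℝ (Fin (2 * n + 1))) f (fun x => -f x) univ →
        IsJtTangentOn (EuclideanSpace ℝ (Fin (2 * n + 1))) f (fun x => -f x) univ →
        IsInvolutiveOn (EuclideanSpace ℝ (Fin (2 * n + 1)))
          (distributionD (EuclideanSpace ℝ (Fin (2 * n + 1))) f) univ →
        ∀ x : M,
          ∃ (V : Set (EuclideanSpace ℝ (Fin (2 * n)))) (a b : ℝ)
            (g : EuclideanSpace ℝ (Fin (2 * n)) → Ambient n)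
            (ψ : OpenPartialHomeomorph M (EuclideanSpace ℝ (Fin (2 * n)) × ℝ)),
            IsOpen V ∧ IsParaComplexCentroAffine g V ∧
            x ∈ ψ.source ∧ ψ.target = V ×ˢ Ioo a b ∧
            ContMDiffOn 𝓘(ℝ, EuclideanSpace ℝ (Fin (2 * n + 1)))
              𝓘(ℝ, EuclideanSpace ℝ (Fin (2 * n)) × ℝ) ∞ ψ ψ.source ∧
            ContMDiffOn 𝓘(ℝ, EuclideanSpace ℝ (Fin (2 * n)) × ℝ)
              𝓘(ℝ, EuclideanSpace ℝ (Fin (2 * n + 1))) ∞ ψ.symm ψ.target ∧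
            ∀ p ∈ V ×ˢ Ioo a b, f (ψ.symm p) = hyperbolicSweep g p) ∧
    (∀ (V : Set (EuclideanSpace ℝ (Fin (2 * n)))) (g : EuclideanSpace ℝ (Fin (2 * n)) → Ambient n),
        IsOpen V → IsParaComplexCentroAffine g V →
        IsImmersedOn (EuclideanSpace ℝ (Fin (2 * n)) × ℝ) (hyperbolicSweep g) (V ×ˢ univ) ∧
        IsTransversalOn (EuclideanSpace ℝ (Fin (2 * n)) × ℝ) (hyperbolicSweep g)
          (fun p => -hyperbolicSweep g p) (V ×ˢ univ) ∧
        IsJtTangentOn (EuclideanSpace ℝ (Fin (2 * n)) × ℝ) (hyperbolicSweep g)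
          (fun p => -hyperbolicSweep g p) (V ×ˢ univ) ∧
        IsInvolutiveOn (EuclideanSpace ℝ (Fin (2 * n)) × ℝ)
          (distributionD (EuclideanSpace ℝ (Fin (2 * n)) × ℝ) (hyperbolicSweep g)) (V ×ˢ univ) ∧
        (IsParaNondegenerate g V →
          IsNondegenerateOn (EuclideanSpace ℝ (Fin (2 * n)) × ℝ) (hyperbolicSweep g)
            (fun p => -hyperbolicSweep g p) (V ×ˢ univ))) := by
  refine ⟨fun M _ _ _ f hf htr htan hinv x => ?_, fun V g hV hg => ?_⟩
  · exact exists_sweep_coordinates_of_involutive finrank_euclideanSpace_fin hf htr htan hinv x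
  · exact ⟨hg.isImmersedOn_hyperbolicSweep hV, hg.isTransversalOn_hyperbolicSweep hV,
      hg.isJtTangentOn_hyperbolicSweep hV, hg.isInvolutiveOn_hyperbolicSweep hV,
      hg.isNondegenerateOn_hyperbolicSweep hV⟩
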